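/- **Division Estimate.** Write $\langle z\rangle = 1+|z|$. Let $f$ be the Blasius profile, $ff''+f'''=0$ on $[0,\infty)$, $f(0)=f'(0)=0$, $f'(\eta)\to 1$ and $f(\eta)/\eta\to1$ as $\eta\to\infty$, and let $\bar u(x,y)=f'\big(y/\sqrt{x+1}\big)$. Through the stream function $\psi=\int_0^y\bar u(x,y')\,dy'$, regard $\bar u$ and $\bar u_{yy}$ as functions of $(x,\psi)$, $x>0$, $\psi\ge 0$. For $\varepsilon>0$ and a function $\phi(x,\psi)$ put $$u=\sqrt{\bar u^2+\varepsilon\phi},\qquad \rho=\frac{u-\bar u}{\varepsilon},\qquad A=-\frac{2\bar u_{yy}}{\bar u\,(2\bar u+\varepsilon\rho)} .$$ Say that $\phi$ solves the perturbed von Mises equation (with regularity index $K_0$) if $\phi$ is smooth on $\{x>0,\psi>0\}$, $\bar u^2+\varepsilon\phi>0$ there, $$\phi_x-(\bar u+\varepsilon\rho)\,\phi_{\psi\psi}+A\phi=0\quad\text{for }x>0,\ \psi>0,$$ $\phi(x,0)=0$ and $\phi(x,\psi)\to0$ as $\psi\to\infty$ for every $x>0$, and $\phi^{(k)}:=\partial_x^k\phi$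 and $\phi^{(k)}_\psi$ are continuous up to $\psi=0$ for $k\le K_0$. Given $0=\sigma_0<\sigma_1<\sigma_2<\cdots$, let $\|\phi\|_X=\sum_{k=0}^{K_0}\|\phi\|_{X_k}$ with $$\|\phi\|_{X_k}=\big\|\phi^{(k)}\langle x\rangle^{k-\sigma_k}\big\|_{L^\infty_xL^2_\psi}+\Big\|\phi^{(k)}\tfrac{\langle\sqrt\psi\rangle}{\sqrt u}\langle x\rangle^{k-\sigma_k}\Big\|_{L^\infty_xL^2_\psi}+\big\|\sqrt u\,\phi^{(k)}_\psi\langle x\rangle^{k-\sigma_k}\big\|_{L^2_xL^2_\psi}+\big\|\phi^{(k)}_\psi\sqrt\psi\,\langle x\rangle^{k-\sigma_k}\big\|_{L^2_xL^2_\psi},$$ where $x,\psi\in(0,\infty)$. There are $\kappa>0$, $\sigma_{\max}>0$ and $K_{\min}$ such that for all $K_0\ge K_{\min}$, all sequences $\sigma$ as above with $\sigma_k\le\sigma_{\max}$ for $k\le K_0$, and all $M>0$ there are $\varepsilon_0>0$ and $C>0$ with the following property. Let $0<\varepsilon\le\varepsilon_0$ and let $\phi$ solve the perturbed von Mises equation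 with $\|\phi\|_X\le M$. Then for every $x>0$ the integrals $\int_0^\infty\phi^2\frac{\langle\psi\rangle}{u}\,d\psi$ and $\int_0^\infty\phi_\psi^2\langle\psi\rangle\,d\psi$ are finite, the first one is differentiable in $x$, and $$\frac12\,\frac{d}{dx}\int_0^\infty\phi^2\,\frac{\langle\psi\rangle}{u}\,d\psi+\int_0^\infty\phi_\psi^2\,\langle\psi\rangle\,d\psi\ \le\ \varepsilon\,\langle x\rangle^{-(1+\kappa)}E_{K_0}(x)\qquad (x>0)$$ for some function $E_{K_0}$ with $\sup_{x>0}|E_{K_0}(x)|\le C\,\|\phi\|_X$. -/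

import Mathlib

open MeasureTheory Set Filter Topology
open scoped ENNReal ContDiff

noncomputable section

namespace VonMises

/-- The bracket `⟨z⟩`, normalised as `1 + |z|`. -/
def bracket (z : ℝ) : ℝ := 1 + |z|

/-! ### The Blasius flow -/

/-- `f` is a Blasius profile on `[0, ∞)`: `f f'' + f''' = 0`, `f 0 = f' 0 = 0`, `f' → 1` and
`f η / η → 1` as `η → ∞`.  The values of `f` at negative arguments play no role
(a solution on `[0, ∞)` is smooth up to `0`, so it has a smooth extension). -/
structure IsBlasiusProfile (f : ℝ → ℝ) : Prop where
  contDiff : ContDiff ℝ 3 f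
  ode : ∀ η : ℝ, 0 ≤ η → f η * iteratedDeriv 2 f η + iteratedDeriv 3 f η = 0
  zero : f 0 = 0
  deriv_zero : deriv f 0 = 0
  deriv_tendsto : Tendsto (deriv f) atTop (𝓝 1)
  div_tendsto : Tendsto (fun η : ℝ => f η / η) atTop (𝓝 1)

/-- The tangential Blasius velocity in physical variables, with `x₀ = 1`. -/
def blasiusU (f : ℝ → ℝ) (x y : ℝ) : ℝ := deriv f (y / Real.sqrt (x + 1))

/-- The Blasius stream function `ψ = ∫₀^y ū(x, y') dy'`. -/
def blasiusStream (f : ℝ → ℝ) (x y : ℝ) : ℝ := ∫ t in (0 : ℝ)..y, blasiusU f x t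

/-- The inverse of `y ↦ ψ(x, y)` on `[0, ∞)`. -/
def blasiusY (f : ℝ → ℝ) (x ψ : ℝ) : ℝ := Function.invFunOn (blasiusStream f x) (Ici 0) ψ

/-- `ū` as a function of the von Mises variables `(x, ψ)`. -/
def ubar (f : ℝ → ℝ) (x ψ : ℝ) : ℝ := blasiusU f x (blasiusY f x ψ)

/-- `ū_yy` (two derivatives in the physical variable `y`), evaluated at `(x, ψ)`. -/
def ubarYY (f : ℝ → ℝ) (x ψ : ℝ) : ℝ := iteratedDeriv 2 (blasiusU f x) (blasiusY f x ψ)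

/-! ### The perturbation and its equation -/

/-- The full velocity `u`, determined by `u ^ 2 = ū ^ 2 + ε φ` and `u ≥ 0`. -/
def vel (f : ℝ → ℝ) (ε : ℝ) (φ : ℝ → ℝ → ℝ) (x ψ : ℝ) : ℝ :=
  Real.sqrt (ubar f x ψ ^ 2 + ε * φ x ψ)

/-- The velocity perturbation `ρ`, determined by `u = ū + ε ρ`. -/
def rho (f : ℝ → ℝ) (ε : ℝ) (φ : ℝ → ℝ → ℝ) (x ψ : ℝ) : ℝ :=
  (vel f ε φ x ψ - ubar f x ψ) / ε

/-- The coefficient `A = - 2 ū_yy / (ū (2 ū + ε ρ))`. -/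
def coeffA (f : ℝ → ℝ) (ε : ℝ) (φ : ℝ → ℝ → ℝ) (x ψ : ℝ) : ℝ :=
  -2 * (ubarYY f x ψ / (ubar f x ψ * (2 * ubar f x ψ + ε * rho f ε φ x ψ)))

/-- `φ^(k) = ∂_x^k φ` at fixed `ψ`. -/
def dx (k : ℕ) (φ : ℝ → ℝ → ℝ) (x ψ : ℝ) : ℝ := iteratedDeriv k (fun x' => φ x' ψ) x

/-- `∂_ψ g` at fixed `x`. -/
def dpsi (g : ℝ → ℝ → ℝ) (x ψ : ℝ) : ℝ := deriv (g x) ψ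

/-- `φ` is a classical solution on `x > 0`, `ψ > 0` of
`φ_x - (ū + ε ρ) φ_ψψ + A φ = 0` with `u > 0` inside, `u = 0` on the wall and `u → 1` at infinity
(that is `φ = 0` at `ψ = 0` and `φ → 0` as `ψ → ∞`).  It is smooth inside, and `φ^(k)`, `φ^(k)_ψ`,
`k ≤ K`, are continuous up to the wall. -/
structure IsSolution (f : ℝ → ℝ) (ε : ℝ) (K : ℕ) (φ : ℝ → ℝ → ℝ) : Prop where
  smooth : ContDiffOn ℝ ∞ (fun p : ℝ × ℝ => φ p.1 p.2) {p | 0 < p.1 ∧ 0 < p.2}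
  pos : ∀ x ψ : ℝ, 0 < x → 0 < ψ → 0 < ubar f x ψ ^ 2 + ε * φ x ψ
  eqn : ∀ x ψ : ℝ, 0 < x → 0 < ψ →
    dx 1 φ x ψ - (ubar f x ψ + ε * rho f ε φ x ψ) * dpsi (dpsi φ) x ψ
      + coeffA f ε φ x ψ * φ x ψ = 0
  wall : ∀ x : ℝ, 0 < x → φ x 0 = 0
  far : ∀ x : ℝ, 0 < x → Tendsto (φ x) atTop (𝓝 0)
  continuous_dx : ∀ k ≤ K,
    ContinuousOn (fun p : ℝ × ℝ => dx k φ p.1 p.2) {p | 0 < p.1 ∧ 0 ≤ p.2}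
  continuous_dpsi : ∀ k ≤ K, ∃ g : ℝ × ℝ → ℝ, ContinuousOn g {p | 0 < p.1 ∧ 0 ≤ p.2} ∧
    ∀ p : ℝ × ℝ, 0 < p.1 → 0 < p.2 → g p = dpsi (dx k φ) p.1 p.2

/-! ### The norms -/

/-- The norm of `L²` in `ψ ∈ (0, ∞)`. -/
def normL2 (g : ℝ → ℝ) : ℝ≥0∞ := eLpNorm g 2 (volume.restrict (Ioi 0))

/-- The norm of `L^∞` in `x ∈ (0, ∞)` with values in `L²` in `ψ`. -/
def normLinfL2 (G : ℝ → ℝ → ℝ) : ℝ≥0∞ := ⨆ (x : ℝ) (_ : 0 < x), normL2 (G x)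

/-- The norm of `L²` in `x ∈ (0, ∞)` with values in `L²` in `ψ`. -/
def normL2L2 (G : ℝ → ℝ → ℝ) : ℝ≥0∞ :=
  (∫⁻ x in Ioi (0 : ℝ), normL2 (G x) ^ (2 : ℕ)) ^ (1 / 2 : ℝ)

/-- The norm `‖φ‖_{X_k}`. -/
def normXk (f : ℝ → ℝ) (ε : ℝ) (σ : ℕ → ℝ) (φ : ℝ → ℝ → ℝ) (k : ℕ) : ℝ≥0∞ :=
  normLinfL2 (fun x ψ => dx k φ x ψ * bracket x ^ ((k : ℝ) - σ k))
  + normLinfL2 (fun x ψ => dx k φ x ψ * (bracket (Real.sqrt ψ) / Real.sqrt (vel f ε φ x ψ))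
      * bracket x ^ ((k : ℝ) - σ k))
  + normL2L2 (fun x ψ => Real.sqrt (vel f ε φ x ψ) * dpsi (dx k φ) x ψ
      * bracket x ^ ((k : ℝ) - σ k))
  + normL2L2 (fun x ψ => dpsi (dx k φ) x ψ * Real.sqrt ψ * bracket x ^ ((k : ℝ) - σ k))

/-- The norm `‖φ‖_X = ∑_{k ≤ K₀} ‖φ‖_{X_k}`. -/
def normX (f : ℝ → ℝ) (ε : ℝ) (σ : ℕ → ℝ) (K₀ : ℕ) (φ : ℝ → ℝ → ℝ) : ℝ≥0∞ :=
  ∑ k ∈ Finset.range (K₀ + 1), normXk f ε σ φ k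

/-! ### The two quantities on the left-hand side -/

/-- The density `φ² ⟨ψ⟩ / u`. -/
def divDensity (f : ℝ → ℝ) (ε : ℝ) (φ : ℝ → ℝ → ℝ) (x ψ : ℝ) : ℝ :=
  φ x ψ ^ 2 * (1 / vel f ε φ x ψ) * bracket ψ

/-- The density `φ_ψ² ⟨ψ⟩`. -/
def dissDensity (φ : ℝ → ℝ → ℝ) (x ψ : ℝ) : ℝ := dpsi φ x ψ ^ 2 * bracket ψ

/-- `∫ φ² ⟨ψ⟩ / u dψ`. -/
def divEnergy (f : ℝ → ℝ) (ε : ℝ) (φ : ℝ → ℝ → ℝ) (x : ℝ) : ℝ :=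
  ∫ ψ in Ioi (0 : ℝ), divDensity f ε φ x ψ

/-- `∫ φ_ψ² ⟨ψ⟩ dψ`. -/
def dissipation (φ : ℝ → ℝ → ℝ) (x : ℝ) : ℝ := ∫ ψ in Ioi (0 : ℝ), dissDensity φ x ψ

end VonMises

end

/-!
Fix `x > 0`, put `w = u² = ū² + ε φ`, and write `N` for the norm of `φ`.  Multiplying the equation by
`φ ⟨ψ⟩ / u` and integrating gives

  `½ d/dx ∫ φ² ⟨ψ⟩ / u + ∫ φ_ψ² ⟨ψ⟩ ≤ - ∫ (A + wₓ / (4 w)) φ² ⟨ψ⟩ / u`,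

because the weight `⟨ψ⟩ = 1 + ψ` is affine and `φ` vanishes at the wall
(`integral_sq_deriv_mul_le`).  Here `wₓ = ū_yy + ε φₓ`, since `∂ₓ(ū²) = ū_yy` at fixed `ψ` for the
profile at hand.  As `ū_yy ≤ 0`, the part `A + ū_yy / (4 w)` is nonnegative as soon as `u ≥ ū / 2`, so
it is damping, and the only error is the cubic term `ε ∫ φ² φₓ ⟨ψ⟩ / (4 u³)`
(`half_divDensityDx_le`).

Both `u ≥ ū / 2` and the bound of the cubic term follow from `|φ| ≲ N ⟨x⟩ ^ (σ₁ - 1 / 4) ū²`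
(`Slice.abs_le_mul_sqProfile`), proved at each time separately.  The `L^∞_x L²_ψ` norms of `φ` and
`φₓ` with the weight `⟨√ψ⟩ / √u`, and the equation `u φ_ψψ = φₓ + A φ` with `0 ≤ A ≤ 2 / (x + 1)`,
bound `√u φ_ψψ` in `L²` (`Slice.energy₂`); an integration by parts then bounds `φ_ψ` in `L²`, and
`φ` in `L^∞` (`Slice.abs_le`).  Neither step needs a lower bound on `u`.  Away from the wall this
suffices.  Near the wall a Lipschitz bound on `φ` is needed, and there `u` degenerates.  Starting
from a point `ξ` of size `√(x + 1)` at which `φ_ψ` is controlled, one moves down to the wall: as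
long as `w_ψ ≥ m`, where `2 m` is a lower bound of `(ū²)_ψ`, one has
`∫ 1 / √w ≤ m⁻¹ ∫ w_ψ / √w ≲ m⁻¹`, hence `∫ |φ_ψψ| ≤ ‖√u φ_ψψ‖ (∫ 1 / u) ^ (1 / 2)` is bounded, and
for small `ε` the slope `w_ψ` stays strictly above `m` (`abs_deriv_le_of_slope`).

The energy is differentiable by dominated convergence: the `x`-derivative of the density is at most
a multiple of `(φ² + φₓ²) ⟨ψ⟩ / u`, the weight is comparable to one independent of `x` on compact
intervals of times, and `sup_x (φ² + φₓ²)` is controlled by the integral in `x` of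
`φ² + φₓ² + φₓₓ²` (`hasDerivAt_divEnergy`).
-/

namespace VonMises

/-! ### The Blasius profile -/

namespace IsBlasiusProfile

variable {f : ℝ → ℝ}

theorem hasDerivAt (hf : IsBlasiusProfile f) (η : ℝ) : HasDerivAt f (deriv f η) η :=
  ((hf.contDiff.differentiable (by norm_num)) η).hasDerivAt

theorem hasDerivAt_deriv (hf : IsBlasiusProfile f) (η : ℝ) :
    HasDerivAt (deriv f) (iteratedDeriv 2 f η) η := by
  have h := (hf.contDiff.differentiable_iteratedDeriv 1 (by norm_num)) η
  have := h.hasDerivAt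
  rwa [← iteratedDeriv_succ, iteratedDeriv_one] at this

theorem hasDerivAt_iteratedDeriv_two (hf : IsBlasiusProfile f) {η : ℝ} (hη : 0 ≤ η) :
    HasDerivAt (iteratedDeriv 2 f) (-(f η * iteratedDeriv 2 f η)) η := by
  have h := (hf.contDiff.differentiable_iteratedDeriv 2 (by norm_num)) η
  have := h.hasDerivAt
  rw [← iteratedDeriv_succ] at this
  have e := hf.ode η hη
  exact this.congr_deriv (by linarith)

theorem continuous (hf : IsBlasiusProfile f) : Continuous f := hf.contDiff.continuous

/-- The Blasius equation is linear in `f''`, so `f''` is `f'' 0` times a positive factor. -/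
theorem iteratedDeriv_two_eq (hf : IsBlasiusProfile f) {η : ℝ} (hη : 0 ≤ η) :
    iteratedDeriv 2 f η = iteratedDeriv 2 f 0 * Real.exp (-∫ t in (0 : ℝ)..η, f t) := by
  have hF : ∀ y : ℝ, HasDerivAt (fun y => ∫ t in (0 : ℝ)..y, f t) (f y) y := fun y =>
    intervalIntegral.integral_hasDerivAt_right (hf.continuous.intervalIntegrable _ _)
      (hf.continuous.stronglyMeasurableAtFilter _ _) hf.continuous.continuousAt
  have hd : ∀ y : ℝ, 0 ≤ y → HasDerivAt
      (fun y => iteratedDeriv 2 f y * Real.exp (∫ t in (0 : ℝ)..y, f t)) 0 y := by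
    intro y hy
    have := (hf.hasDerivAt_iteratedDeriv_two hy).mul (hF y).exp
    exact this.congr_deriv (by ring)
  have hc := constant_of_has_deriv_right_zero (a := 0) (b := η)
    (f := fun y => iteratedDeriv 2 f y * Real.exp (∫ t in (0 : ℝ)..y, f t))
    (fun y hy => (hd y hy.1).continuousAt.continuousWithinAt)
    (fun y hy => (hd y hy.1).hasDerivWithinAt) η ⟨hη, le_rfl⟩
  simp only [intervalIntegral.integral_same, Real.exp_zero, mul_one] at hc
  rw [← hc, mul_assoc, ← Real.exp_add]
  simp

theorem iteratedDeriv_two_zero_pos (hf : IsBlasiusProfile f) : 0 < iteratedDeriv 2 f 0 := by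
  by_contra! h
  have hanti : AntitoneOn (deriv f) (Ici 0) := by
    refine antitoneOn_of_deriv_nonpos (convex_Ici 0)
      (fun y _ => (hf.hasDerivAt_deriv y).continuousAt.continuousWithinAt)
      (fun y _ => (hf.hasDerivAt_deriv y).differentiableAt.differentiableWithinAt) ?_
    intro y hy
    rw [interior_Ici] at hy
    rw [(hf.hasDerivAt_deriv y).deriv, hf.iteratedDeriv_two_eq (le_of_lt hy)]
    exact mul_nonpos_of_nonpos_of_nonneg h (Real.exp_pos _).le
  have : (1 : ℝ) ≤ 0 := by
    refine le_of_tendsto hf.deriv_tendsto ?_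
    filter_upwards [eventually_ge_atTop 0] with y hy
    simpa [hf.deriv_zero] using hanti (mem_Ici.2 le_rfl) (mem_Ici.2 hy) hy
  linarith

theorem iteratedDeriv_two_pos (hf : IsBlasiusProfile f) {η : ℝ} (hη : 0 ≤ η) :
    0 < iteratedDeriv 2 f η := by
  rw [hf.iteratedDeriv_two_eq hη]
  exact mul_pos hf.iteratedDeriv_two_zero_pos (Real.exp_pos _)

theorem strictMonoOn_deriv (hf : IsBlasiusProfile f) : StrictMonoOn (deriv f) (Ici 0) := by
  refine strictMonoOn_of_deriv_pos (convex_Ici 0)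
    (fun y _ => (hf.hasDerivAt_deriv y).continuousAt.continuousWithinAt) ?_
  intro y hy
  rw [interior_Ici] at hy
  rw [(hf.hasDerivAt_deriv y).deriv]
  exact hf.iteratedDeriv_two_pos (le_of_lt hy)

theorem deriv_pos (hf : IsBlasiusProfile f) {η : ℝ} (hη : 0 < η) : 0 < deriv f η := by
  simpa [hf.deriv_zero] using hf.strictMonoOn_deriv (mem_Ici.2 le_rfl) (mem_Ici.2 hη.le) hη

theorem deriv_le_one (hf : IsBlasiusProfile f) {η : ℝ} (hη : 0 ≤ η) : deriv f η ≤ 1 := by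
  refine ge_of_tendsto hf.deriv_tendsto ?_
  filter_upwards [eventually_ge_atTop η] with y hy
  exact hf.strictMonoOn_deriv.monotoneOn (mem_Ici.2 hη) (mem_Ici.2 (hη.trans hy)) hy

theorem strictMonoOn (hf : IsBlasiusProfile f) : StrictMonoOn f (Ici 0) := by
  refine strictMonoOn_of_deriv_pos (convex_Ici 0) hf.continuous.continuousOn ?_
  intro y hy
  rw [interior_Ici] at hy
  exact hf.deriv_pos hy

theorem nonneg (hf : IsBlasiusProfile f) {η : ℝ} (hη : 0 ≤ η) : 0 ≤ f η := by
  simpa [hf.zero] using hf.strictMonoOn.monotoneOn (mem_Ici.2 le_rfl) (mem_Ici.2 hη) hη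

theorem antitoneOn_iteratedDeriv_two (hf : IsBlasiusProfile f) :
    AntitoneOn (iteratedDeriv 2 f) (Ici 0) := by
  refine antitoneOn_of_deriv_nonpos (convex_Ici 0)
    (fun y hy => (hf.hasDerivAt_iteratedDeriv_two hy).continuousAt.continuousWithinAt)
    (fun y hy => ?_) ?_
  · rw [interior_Ici] at hy
    exact (hf.hasDerivAt_iteratedDeriv_two
      (le_of_lt hy)).differentiableAt.differentiableWithinAt
  · intro y hy
    rw [interior_Ici] at hy
    have hy' : (0 : ℝ) ≤ y := le_of_lt hy
    rw [(hf.hasDerivAt_iteratedDeriv_two hy').deriv]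
    have := mul_nonneg (hf.nonneg hy') (hf.iteratedDeriv_two_pos hy').le
    linarith

/-- In von Mises variables this is the tangent inequality at the wall for the concave function
`s ↦ ū²`. -/
theorem two_mul_mul_le_sq (hf : IsBlasiusProfile f) {η : ℝ} (hη : 0 ≤ η) :
    2 * (f η * iteratedDeriv 2 f η) ≤ deriv f η ^ 2 := by
  have hd : ∀ y : ℝ, 0 ≤ y → HasDerivAt
      (fun y => deriv f y ^ 2 - 2 * (f y * iteratedDeriv 2 f y))
      (2 * (f y ^ 2 * iteratedDeriv 2 f y)) y := by
    intro y hy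
    have := ((hf.hasDerivAt_deriv y).pow 2).sub
      (((hf.hasDerivAt y).mul (hf.hasDerivAt_iteratedDeriv_two hy)).const_mul 2)
    exact this.congr_deriv (by simp; ring)
  have hm : MonotoneOn (fun y => deriv f y ^ 2 - 2 * (f y * iteratedDeriv 2 f y)) (Ici 0) := by
    refine monotoneOn_of_deriv_nonneg (convex_Ici 0)
      (fun y hy => (hd y hy).continuousAt.continuousWithinAt) (fun y hy => ?_) ?_
    · rw [interior_Ici] at hy
      exact (hd y (le_of_lt hy)).differentiableAt.differentiableWithinAt
    · intro y hy
      rw [interior_Ici] at hy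
      rw [(hd y (le_of_lt hy)).deriv]
      have := hf.iteratedDeriv_two_pos (le_of_lt hy : (0 : ℝ) ≤ y)
      positivity
  have := hm (mem_Ici.2 le_rfl) (mem_Ici.2 hη) hη
  simp only [hf.zero, hf.deriv_zero] at this
  linarith

theorem surjOn (hf : IsBlasiusProfile f) : SurjOn f (Ici 0) (Ici 0) := by
  have ht : Tendsto f atTop atTop := by
    have h := hf.div_tendsto.pos_mul_atTop one_pos tendsto_id
    refine h.congr' ?_
    filter_upwards [eventually_gt_atTop 0] with y hy
    simp [hy.ne']
  intro s hs
  obtain ⟨b, hb0, hb⟩ := ((eventually_ge_atTop (0 : ℝ)).and (ht.eventually_ge_atTop s)).exists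
  obtain ⟨y, hy, rfl⟩ := intermediate_value_Icc hb0 hf.continuous.continuousOn
    (show s ∈ Icc (f 0) (f b) from ⟨by simpa [hf.zero] using hs, hb⟩)
  exact ⟨y, hy.1, rfl⟩

end IsBlasiusProfile

/-- The inverse of a Blasius profile on `[0, ∞)`: the similarity variable `η` as a function of
`s = ψ / √(x + 1)`. -/
noncomputable def etaOf (f : ℝ → ℝ) (s : ℝ) : ℝ := Function.invFunOn f (Ici 0) s

/-- The profile of `ū²` in the variable `s = ψ / √(x + 1)`. -/
noncomputable def sqProfile (f : ℝ → ℝ) (s : ℝ) : ℝ := deriv f (etaOf f s) ^ 2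

/-- Half the derivative of `sqProfile f`, the profile of `√(x + 1) ū_y`. -/
noncomputable def shearProfile (f : ℝ → ℝ) (s : ℝ) : ℝ := iteratedDeriv 2 f (etaOf f s)

namespace IsBlasiusProfile

variable {f : ℝ → ℝ}

theorem etaOf_nonneg (hf : IsBlasiusProfile f) {s : ℝ} (hs : 0 ≤ s) : 0 ≤ etaOf f s :=
  Function.invFunOn_mem (hf.surjOn hs)

theorem apply_etaOf (hf : IsBlasiusProfile f) {s : ℝ} (hs : 0 ≤ s) : f (etaOf f s) = s :=
  Function.invFunOn_eq (hf.surjOn hs)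

theorem etaOf_apply (hf : IsBlasiusProfile f) {η : ℝ} (hη : 0 ≤ η) : etaOf f (f η) = η :=
  hf.strictMonoOn.injOn (hf.etaOf_nonneg (hf.nonneg hη)) hη (hf.apply_etaOf (hf.nonneg hη))

theorem strictMonoOn_etaOf (hf : IsBlasiusProfile f) : StrictMonoOn (etaOf f) (Ici 0) := by
  intro s hs s' hs' h
  by_contra! hle
  have := hf.strictMonoOn.monotoneOn (hf.etaOf_nonneg hs') (hf.etaOf_nonneg hs) hle
  rw [hf.apply_etaOf hs, hf.apply_etaOf hs'] at this
  linarith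

theorem etaOf_pos (hf : IsBlasiusProfile f) {s : ℝ} (hs : 0 < s) : 0 < etaOf f s :=
  (hf.etaOf_nonneg le_rfl).trans_lt
    (hf.strictMonoOn_etaOf (mem_Ici.2 le_rfl) (mem_Ici.2 hs.le) hs)

theorem continuousAt_etaOf (hf : IsBlasiusProfile f) {s : ℝ} (hs : 0 < s) :
    ContinuousAt (etaOf f) s := by
  refine hf.strictMonoOn_etaOf.continuousAt_of_image_mem_nhds (Ici_mem_nhds hs) ?_
  refine mem_of_superset (Ici_mem_nhds (hf.etaOf_pos hs)) fun η hη => ?_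
  exact ⟨f η, hf.nonneg hη, hf.etaOf_apply hη⟩

theorem hasDerivAt_etaOf (hf : IsBlasiusProfile f) {s : ℝ} (hs : 0 < s) :
    HasDerivAt (etaOf f) (deriv f (etaOf f s))⁻¹ s := by
  refine (hf.hasDerivAt (etaOf f s)).of_local_left_inverse (hf.continuousAt_etaOf hs)
    (hf.deriv_pos (hf.etaOf_pos hs)).ne' ?_
  filter_upwards [Ioi_mem_nhds hs] with s' hs'
  exact hf.apply_etaOf (le_of_lt hs')

theorem hasDerivAt_sqProfile (hf : IsBlasiusProfile f) {s : ℝ} (hs : 0 < s) :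
    HasDerivAt (sqProfile f) (2 * shearProfile f s) s := by
  have h := ((hf.hasDerivAt_deriv (etaOf f s)).comp s (hf.hasDerivAt_etaOf hs)).pow 2
  have hne := (hf.deriv_pos (hf.etaOf_pos hs)).ne'
  refine h.congr_deriv ?_
  simp only [shearProfile, Function.comp]
  field_simp
  norm_num
  ring

theorem continuousOn_shearProfile (hf : IsBlasiusProfile f) :
    ContinuousOn (shearProfile f) (Ioi 0) := fun _ hs =>
  (ContinuousAt.comp (f := etaOf f) (g := iteratedDeriv 2 f)
    (hf.hasDerivAt_iteratedDeriv_two (hf.etaOf_nonneg (le_of_lt hs))).continuousAt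
    (hf.continuousAt_etaOf hs)).continuousWithinAt

theorem shearProfile_pos (hf : IsBlasiusProfile f) {s : ℝ} (hs : 0 < s) : 0 < shearProfile f s :=
  hf.iteratedDeriv_two_pos (hf.etaOf_nonneg hs.le)

theorem antitoneOn_shearProfile (hf : IsBlasiusProfile f) :
    AntitoneOn (shearProfile f) (Ioi 0) := fun _ hs _ hs' h =>
  hf.antitoneOn_iteratedDeriv_two (hf.etaOf_nonneg (le_of_lt hs)) (hf.etaOf_nonneg (le_of_lt hs'))
    (hf.strictMonoOn_etaOf.monotoneOn (mem_Ici.2 (le_of_lt hs)) (mem_Ici.2 (le_of_lt hs')) h)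

theorem sqProfile_le_one (hf : IsBlasiusProfile f) {s : ℝ} (hs : 0 < s) : sqProfile f s ≤ 1 :=
  pow_le_one₀ (hf.deriv_pos (hf.etaOf_pos hs)).le (hf.deriv_le_one (hf.etaOf_nonneg hs.le))

theorem sqProfile_pos (hf : IsBlasiusProfile f) {s : ℝ} (hs : 0 < s) : 0 < sqProfile f s :=
  pow_pos (hf.deriv_pos (hf.etaOf_pos hs)) 2

theorem two_mul_shearProfile_le (hf : IsBlasiusProfile f) {s : ℝ} (hs : 0 < s) :
    2 * (s * shearProfile f s) ≤ sqProfile f s := by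
  have := hf.two_mul_mul_le_sq (hf.etaOf_nonneg hs.le)
  rwa [hf.apply_etaOf hs.le] at this

theorem monotoneOn_sqProfile (hf : IsBlasiusProfile f) : MonotoneOn (sqProfile f) (Ioi 0) := by
  refine monotoneOn_of_deriv_nonneg (convex_Ioi 0)
    (fun s hs => (hf.hasDerivAt_sqProfile hs).continuousAt.continuousWithinAt)
    (fun s hs => ?_) (fun s hs => ?_) <;> rw [interior_Ioi] at hs
  · exact (hf.hasDerivAt_sqProfile hs).differentiableAt.differentiableWithinAt
  · rw [(hf.hasDerivAt_sqProfile hs).deriv]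
    have := hf.shearProfile_pos hs
    positivity

/-- `ū² / s` decreases, because `ū²` is concave in `s` and vanishes at the wall. -/
theorem antitoneOn_sqProfile_div (hf : IsBlasiusProfile f) :
    AntitoneOn (fun s => sqProfile f s / s) (Ioi 0) := by
  have hd : ∀ s : ℝ, 0 < s → HasDerivAt (fun s => sqProfile f s / s)
      ((2 * shearProfile f s * s - sqProfile f s * 1) / s ^ 2) s := fun s hs =>
    (hf.hasDerivAt_sqProfile hs).div (hasDerivAt_id s) hs.ne'
  refine antitoneOn_of_deriv_nonpos (convex_Ioi 0)
    (fun s hs => (hd s hs).continuousAt.continuousWithinAt)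
    (fun s hs => ?_) (fun s hs => ?_) <;> rw [interior_Ioi] at hs
  · exact (hd s hs).differentiableAt.differentiableWithinAt
  · rw [(hd s hs).deriv]
    have := hf.two_mul_shearProfile_le hs
    exact div_nonpos_of_nonpos_of_nonneg (by linarith) (sq_nonneg s)

theorem le_sqProfile_of_le_one (hf : IsBlasiusProfile f) {s : ℝ} (hs : 0 < s) (hs1 : s ≤ 1) :
    2 * shearProfile f 1 * s ≤ sqProfile f s := by
  have h1 := hf.two_mul_shearProfile_le hs
  have h2 := hf.antitoneOn_shearProfile (mem_Ioi.2 hs) (mem_Ioi.2 one_pos) hs1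
  nlinarith

/-! ### The background flow in von Mises variables -/

theorem blasiusStream_eq (hf : IsBlasiusProfile f) {x : ℝ} (hx : 0 < x) (y : ℝ) :
    blasiusStream f x y = √(x + 1) * f (y / √(x + 1)) := by
  have hr : 0 < √(x + 1) := Real.sqrt_pos.2 (by linarith)
  have hd : ∀ t : ℝ, HasDerivAt (fun t => √(x + 1) * f (t / √(x + 1))) (blasiusU f x t) t := by
    intro t
    have := ((hf.hasDerivAt (t / √(x + 1))).comp t
      ((hasDerivAt_id t).div_const (√(x + 1)))).const_mul (√(x + 1))
    refine this.congr_deriv ?_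
    simp only [blasiusU]
    field_simp
  have hc : Continuous (blasiusU f x) := by
    have : Continuous (deriv f) := hf.contDiff.continuous_deriv (by norm_num)
    exact this.comp (continuous_id.div_const _)
  rw [blasiusStream, intervalIntegral.integral_eq_sub_of_hasDerivAt (fun t _ => hd t)
    (hc.intervalIntegrable _ _)]
  simp [hf.zero]

theorem blasiusY_div (hf : IsBlasiusProfile f) {x ψ : ℝ} (hx : 0 < x) (hψ : 0 < ψ) :
    blasiusY f x ψ / √(x + 1) = etaOf f (ψ / √(x + 1)) := by
  have hr : 0 < √(x + 1) := Real.sqrt_pos.2 (by linarith)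
  have hs : 0 ≤ ψ / √(x + 1) := by positivity
  have hex : ∃ y ∈ Ici (0 : ℝ), blasiusStream f x y = ψ := by
    refine ⟨√(x + 1) * etaOf f (ψ / √(x + 1)), mul_nonneg hr.le (hf.etaOf_nonneg hs), ?_⟩
    rw [hf.blasiusStream_eq hx, mul_div_cancel_left₀ _ hr.ne', hf.apply_etaOf hs]
    field_simp
  have h1 : 0 ≤ blasiusY f x ψ := Function.invFunOn_mem hex
  have h2 : blasiusStream f x (blasiusY f x ψ) = ψ := Function.invFunOn_eq hex
  rw [hf.blasiusStream_eq hx] at h2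
  have h3 : f (blasiusY f x ψ / √(x + 1)) = ψ / √(x + 1) := by
    rw [eq_div_iff hr.ne']
    linarith
  rw [← h3, hf.etaOf_apply (by positivity)]

theorem ubar_sq (hf : IsBlasiusProfile f) {x ψ : ℝ} (hx : 0 < x) (hψ : 0 < ψ) :
    ubar f x ψ ^ 2 = sqProfile f (ψ / √(x + 1)) := by
  rw [ubar, blasiusU, hf.blasiusY_div hx hψ, sqProfile]

theorem ubar_pos (hf : IsBlasiusProfile f) {x ψ : ℝ} (hx : 0 < x) (hψ : 0 < ψ) :
    0 < ubar f x ψ := by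
  have hr : 0 < √(x + 1) := Real.sqrt_pos.2 (by linarith)
  rw [ubar, blasiusU, hf.blasiusY_div hx hψ]
  exact hf.deriv_pos (hf.etaOf_pos (by positivity))

theorem ubarYY_eq (hf : IsBlasiusProfile f) {x ψ : ℝ} (hx : 0 < x) (hψ : 0 < ψ) :
    ubarYY f x ψ = -(ψ / √(x + 1) * shearProfile f (ψ / √(x + 1)) / (x + 1)) := by
  have hr : 0 < √(x + 1) := Real.sqrt_pos.2 (by linarith)
  have hs : 0 ≤ ψ / √(x + 1) := by positivity
  have h1 : ∀ y, HasDerivAt (blasiusU f x) (iteratedDeriv 2 f (y / √(x + 1)) / √(x + 1)) y := by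
    intro y
    have := (hf.hasDerivAt_deriv (y / √(x + 1))).comp y
      ((hasDerivAt_id y).div_const (√(x + 1)))
    exact this.congr_deriv (mul_one_div _ _)
  have h2 : deriv (blasiusU f x) = fun y => iteratedDeriv 2 f (y / √(x + 1)) / √(x + 1) :=
    funext fun y => (h1 y).deriv
  have hη : 0 ≤ blasiusY f x ψ / √(x + 1) := by
    rw [hf.blasiusY_div hx hψ]
    exact hf.etaOf_nonneg hs
  have h4 := ((hf.hasDerivAt_iteratedDeriv_two hη).comp (blasiusY f x ψ)
    ((hasDerivAt_id (blasiusY f x ψ)).div_const (√(x + 1)))).div_const (√(x + 1))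
  rw [ubarYY, iteratedDeriv_succ, iteratedDeriv_one, h2]
  refine h4.deriv.trans ?_
  rw [hf.blasiusY_div hx hψ, hf.apply_etaOf hs, ← shearProfile]
  have hrr : √(x + 1) * √(x + 1) = x + 1 := Real.mul_self_sqrt (by linarith)
  rw [mul_one_div, div_div, hrr, neg_div]

/-- At fixed `ψ` one has `∂ₓ(ū²) = ū_yy`: the equation `f f'' + f''' = 0` with the similarity
variable `y / √(x + 1)` yields half of the value `2 ū_yy` that the Prandtl system would give. -/
theorem hasDerivAt_ubar_sq (hf : IsBlasiusProfile f) {x ψ : ℝ} (hx : 0 < x) (hψ : 0 < ψ) :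
    HasDerivAt (fun x => sqProfile f (ψ / √(x + 1))) (ubarYY f x ψ) x := by
  have hr : 0 < √(x + 1) := Real.sqrt_pos.2 (by linarith)
  have h1 : HasDerivAt (fun x : ℝ => √(x + 1)) (1 / (2 * √(x + 1))) x :=
    ((hasDerivAt_id x).add_const (1 : ℝ)).sqrt (by simp; linarith)
  have h2 : HasDerivAt (fun x : ℝ => ψ / √(x + 1))
      ((0 * √(x + 1) - ψ * (1 / (2 * √(x + 1)))) / √(x + 1) ^ 2) x :=
    (hasDerivAt_const x ψ).div h1 hr.ne'
  have h3 := (hf.hasDerivAt_sqProfile (show 0 < ψ / √(x + 1) by positivity)).comp x h2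
  refine h3.congr_deriv ?_
  rw [hf.ubarYY_eq hx hψ]
  have hrr : √(x + 1) ^ 2 = x + 1 := Real.sq_sqrt (by linarith)
  rw [hrr]
  field_simp
  ring

end IsBlasiusProfile

/-! ### Cauchy–Schwarz and integration by parts on the half-line -/

section
variable {α : Type*} [MeasurableSpace α] {μ : Measure α}

/-- The Cauchy–Schwarz inequality, in a form that leaves the two factors squared. -/
theorem integrable_of_sq_le_mul {m p q : α → ℝ} {a b : ℝ} (hm : AEStronglyMeasurable m μ)
    (hp : Integrable p μ) (hq : Integrable q μ) (hp0 : ∀ᵐ z ∂μ, 0 ≤ p z)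
    (hq0 : ∀ᵐ z ∂μ, 0 ≤ q z) (hmpq : ∀ᵐ z ∂μ, m z ^ 2 ≤ p z * q z)
    (ha : 0 ≤ a) (hb : 0 ≤ b) (hpa : ∫ z, p z ∂μ ≤ a ^ 2) (hqb : ∫ z, q z ∂μ ≤ b ^ 2) :
    Integrable m μ ∧ ∫ z, |m z| ∂μ ≤ a * b := by
  have memLp_sqrt : ∀ {p : α → ℝ}, Integrable p μ → (∀ᵐ z ∂μ, 0 ≤ p z) →
      MemLp (fun z => √(p z)) 2 μ := by
    intro p hp hp0
    rw [memLp_two_iff_integrable_sq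
      (Real.continuous_sqrt.comp_aestronglyMeasurable hp.aestronglyMeasurable)]
    refine hp.congr ?_
    filter_upwards [hp0] with z hz
    rw [Real.sq_sqrt hz]
  have hle : ∀ᵐ z ∂μ, |m z| ≤ √(p z) * √(q z) := by
    filter_upwards [hp0, hmpq] with z h1 h2
    rw [← Real.sqrt_mul h1]
    exact Real.abs_le_sqrt h2
  have hint : Integrable (fun z => √(p z) * √(q z)) μ :=
    (memLp_sqrt hp hp0).integrable_mul (memLp_sqrt hq hq0)
  have hmi : Integrable m μ := hint.mono' hm hle
  refine ⟨hmi, ?_⟩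
  have h2 : ENNReal.ofReal 2 = 2 := by norm_num
  have hH := integral_mul_norm_le_Lp_mul_Lq (μ := μ) (p := 2) (q := 2)
    (f := fun z => √(p z)) (g := fun z => √(q z)) Real.HolderConjugate.two_two
    (h2 ▸ memLp_sqrt hp hp0) (h2 ▸ memLp_sqrt hq hq0)
  have hroot : ∀ {p : α → ℝ} {a : ℝ}, (∀ᵐ z ∂μ, 0 ≤ p z) → 0 ≤ a → ∫ z, p z ∂μ ≤ a ^ 2 →
      (∫ z, ‖√(p z)‖ ^ (2 : ℝ) ∂μ) ^ (1 / 2 : ℝ) ≤ a := by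
    intro p a hp0 ha hpa
    have : ∫ z, ‖√(p z)‖ ^ (2 : ℝ) ∂μ = ∫ z, p z ∂μ := by
      refine integral_congr_ae ?_
      filter_upwards [hp0] with z hz
      rw [Real.rpow_two, Real.norm_eq_abs, sq_abs, Real.sq_sqrt hz]
    rw [this, ← Real.sqrt_eq_rpow]
    exact (Real.sqrt_le_left ha).2 hpa
  calc ∫ z, |m z| ∂μ ≤ ∫ z, ‖√(p z)‖ * ‖√(q z)‖ ∂μ := by
        refine integral_mono_ae hmi.abs ?_ ?_
        · exact hint.norm.congr (Eventually.of_forall fun z => norm_mul _ _)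
        · filter_upwards [hle] with z hz
          simpa [abs_of_nonneg (Real.sqrt_nonneg _)] using hz
    _ ≤ _ := hH
    _ ≤ a * b := mul_le_mul (hroot hp0 ha hpa) (hroot hq0 hb hqb) (by positivity) ha

end

/-- If `g` tends to `0` at infinity, then `(g²)' ≤ 0` at arbitrarily large points. -/
theorem exists_ge_mul_deriv_nonpos {g g₁ : ℝ → ℝ} (hg : ∀ ψ, 0 < ψ → HasDerivAt g (g₁ ψ) ψ)
    (hfar : Tendsto g atTop (𝓝 0)) {R : ℝ} (hR : 0 < R) : ∃ ψ, R ≤ ψ ∧ g ψ * g₁ ψ ≤ 0 := by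
  by_contra! h
  have hd : ∀ ψ, 0 < ψ → HasDerivAt (fun ψ => g ψ ^ 2) (2 * (g ψ * g₁ ψ)) ψ := fun ψ hψ =>
    ((hg ψ hψ).pow 2).congr_deriv (by simp; ring)
  have hm : StrictMonoOn (fun ψ => g ψ ^ 2) (Ici R) := by
    refine strictMonoOn_of_deriv_pos (convex_Ici R)
      (fun ψ hψ => (hd ψ (hR.trans_le hψ)).continuousAt.continuousWithinAt) fun ψ hψ => ?_
    rw [interior_Ici] at hψ
    rw [(hd ψ (hR.trans hψ)).deriv]
    have := h ψ (le_of_lt hψ)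
    positivity
  have h1 : g (R + 1) ^ 2 ≤ 0 := by
    have ht : Tendsto (fun ψ => g ψ ^ 2) atTop (𝓝 0) := by simpa using hfar.pow 2
    refine ge_of_tendsto ht ?_
    filter_upwards [eventually_ge_atTop (R + 1)] with ψ hψ
    exact hm.monotoneOn (mem_Ici.2 (by linarith)) (mem_Ici.2 (by linarith)) hψ
  have h2 : g R ^ 2 < g (R + 1) ^ 2 :=
    hm (mem_Ici.2 le_rfl) (mem_Ici.2 (by linarith)) (by linarith)
  nlinarith [sq_nonneg (g R)]

/-- Integration by parts with the weight `1 + ψ`.  The weight is affine, so no lower order term is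
left; the boundary term at infinity has a favourable sign along a sequence. -/
theorem integral_sq_deriv_mul_le {g g₁ g₂ : ℝ → ℝ}
    (hg : ∀ ψ, 0 < ψ → HasDerivAt g (g₁ ψ) ψ) (hg₁ : ∀ ψ, 0 < ψ → HasDerivAt g₁ (g₂ ψ) ψ)
    (hg₂ : ContinuousOn g₂ (Ioi 0)) (hwall : Tendsto g (𝓝[>] 0) (𝓝 0)) {L : ℝ}
    (hwall₁ : Tendsto g₁ (𝓝[>] 0) (𝓝 L)) (hfar : Tendsto g atTop (𝓝 0))
    (hint : IntegrableOn (fun ψ => g ψ * g₂ ψ * (1 + ψ)) (Ioi 0)) :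
    IntegrableOn (fun ψ => g₁ ψ ^ 2 * (1 + ψ)) (Ioi 0) ∧
      ∫ ψ in Ioi (0 : ℝ), g₁ ψ ^ 2 * (1 + ψ) ≤ -∫ ψ in Ioi (0 : ℝ), g ψ * g₂ ψ * (1 + ψ) := by
  have hgc : ContinuousOn g (Ioi 0) := fun ψ hψ => (hg ψ hψ).continuousAt.continuousWithinAt
  have hg₁c : ContinuousOn g₁ (Ioi 0) := fun ψ hψ => (hg₁ ψ hψ).continuousAt.continuousWithinAt
  have hcw : ContinuousOn (fun ψ : ℝ => 1 + ψ) (Ioi 0) := by fun_prop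
  -- the primitive of `(g₁² + g g₂) (1 + ψ)`
  set H : ℝ → ℝ := fun ψ => (1 + ψ) * (g ψ * g₁ ψ) - g ψ ^ 2 / 2 with hH
  have hHd : ∀ ψ, 0 < ψ → HasDerivAt H (g₁ ψ ^ 2 * (1 + ψ) + g ψ * g₂ ψ * (1 + ψ)) ψ := by
    intro ψ hψ
    have h1 := (((hasDerivAt_id ψ).const_add 1).mul ((hg ψ hψ).mul (hg₁ ψ hψ))).sub
      (((hg ψ hψ).pow 2).div_const 2)
    refine h1.congr_deriv ?_
    simp
    ring
  have hR : ∀ n : ℕ, ∃ ψ, (n : ℝ) + 1 ≤ ψ ∧ g ψ * g₁ ψ ≤ 0 := fun n =>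
    exists_ge_mul_deriv_nonpos hg hfar (by positivity)
  choose R hRn hRs using hR
  set a : ℕ → ℝ := fun n => 1 / ((n : ℝ) + 1) with ha
  have ha0 : ∀ n, 0 < a n := fun n => by positivity
  have haR : ∀ n, a n ≤ R n := fun n => by
    have h1 : a n ≤ 1 := by
      rw [ha, div_le_one (by positivity)]
      linarith [(Nat.cast_nonneg n : (0 : ℝ) ≤ n)]
    linarith [hRn n, (Nat.cast_nonneg n : (0 : ℝ) ≤ n)]
  have hat : Tendsto a atTop (𝓝[>] 0) :=
    tendsto_nhdsWithin_iff.2 ⟨tendsto_one_div_add_atTop_nhds_zero_nat,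
      Eventually.of_forall fun n => ha0 n⟩
  have hRt : Tendsto R atTop atTop := by
    refine tendsto_atTop_mono (fun n => ?_) (tendsto_natCast_atTop_atTop (R := ℝ))
    linarith [hRn n]
  have hcov : AECover (volume.restrict (Ioi (0 : ℝ))) atTop (fun n => Ioc (a n) (R n)) := by
    refine ⟨?_, fun n => measurableSet_Ioc⟩
    filter_upwards [self_mem_ae_restrict measurableSet_Ioi] with ψ hψ
    filter_upwards [(tendsto_nhdsWithin_iff.1 hat).1.eventually_lt_const hψ,
      hRt.eventually_ge_atTop ψ] with n h1 h2
    exact ⟨h1, h2⟩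
  have hsub : ∀ n, Icc (a n) (R n) ⊆ Ioi 0 := fun n ψ hψ => (ha0 n).trans_le hψ.1
  have hres : ∀ n, (volume.restrict (Ioi (0 : ℝ))).restrict (Ioc (a n) (R n))
      = volume.restrict (Ioc (a n) (R n)) := fun n =>
    Measure.restrict_restrict_of_subset (Ioc_subset_Icc_self.trans (hsub n))
  have hi1 : ∀ n, IntegrableOn (fun ψ => g₁ ψ ^ 2 * (1 + ψ)) (Icc (a n) (R n)) := fun n =>
    (((hg₁c.pow 2).mul hcw).mono (hsub n)).integrableOn_Icc
  have hi2 : ∀ n, IntegrableOn (fun ψ => g ψ * g₂ ψ * (1 + ψ)) (Icc (a n) (R n)) := fun n =>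
    (((hgc.mul hg₂).mul hcw).mono (hsub n)).integrableOn_Icc
  have hle : ∀ n, ∫ ψ in Ioc (a n) (R n), g₁ ψ ^ 2 * (1 + ψ) ∂(volume.restrict (Ioi 0))
      ≤ -H (a n) - ∫ ψ in Ioc (a n) (R n), g ψ * g₂ ψ * (1 + ψ) ∂(volume.restrict (Ioi 0)) := by
    intro n
    rw [hres n]
    have h1 := intervalIntegral.integral_eq_sub_of_hasDerivAt_of_le (haR n)
      (f := H) (f' := fun ψ => g₁ ψ ^ 2 * (1 + ψ) + g ψ * g₂ ψ * (1 + ψ))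
      (fun ψ hψ => (hHd ψ (hsub n hψ)).continuousAt.continuousWithinAt)
      (fun ψ hψ => hHd ψ (hsub n (Ioo_subset_Icc_self hψ)))
      ((intervalIntegrable_iff_integrableOn_Icc_of_le (haR n)).2 ((hi1 n).add (hi2 n)))
    rw [intervalIntegral.integral_of_le (haR n),
      integral_add ((hi1 n).mono_set Ioc_subset_Icc_self)
        ((hi2 n).mono_set Ioc_subset_Icc_self)] at h1
    have h2 : H (R n) ≤ 0 := by
      have h3 : (1 + R n) * (g (R n) * g₁ (R n)) ≤ 0 :=
        mul_nonpos_of_nonneg_of_nonpos (by linarith [haR n, ha0 n]) (hRs n)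
      have h4 := sq_nonneg (g (R n))
      simp only [hH]
      linarith
    linarith
  have hHa : Tendsto (fun n => H (a n)) atTop (𝓝 0) := by
    have h1 : Tendsto H (𝓝[>] 0) (𝓝 ((1 + 0) * (0 * L) - 0 ^ 2 / 2)) := by
      refine ((Tendsto.mul ?_ (hwall.mul hwall₁))).sub ((hwall.pow 2).div_const 2)
      exact tendsto_const_nhds.add (tendsto_id.mono_left nhdsWithin_le_nhds)
    have h2 := h1.comp hat
    simp only [add_zero, zero_mul, mul_zero, ne_eq, OfNat.ofNat_ne_zero, not_false_eq_true,
      zero_pow, zero_div, sub_zero] at h2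
    exact h2
  have hlim : Tendsto (fun n => -H (a n)
      - ∫ ψ in Ioc (a n) (R n), g ψ * g₂ ψ * (1 + ψ) ∂(volume.restrict (Ioi 0))) atTop
      (𝓝 (-0 - ∫ ψ in Ioi (0 : ℝ), g ψ * g₂ ψ * (1 + ψ))) :=
    hHa.neg.sub (hcov.integral_tendsto_of_countably_generated hint)
  have hint₁ : IntegrableOn (fun ψ => g₁ ψ ^ 2 * (1 + ψ)) (Ioi 0) := by
    refine hcov.integrable_of_integral_bounded_of_nonneg_ae
      (-0 - (∫ ψ in Ioi (0 : ℝ), g ψ * g₂ ψ * (1 + ψ)) + 1) (fun n => ?_) ?_ ?_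
    · rw [IntegrableOn, hres n]
      exact (hi1 n).mono_set Ioc_subset_Icc_self
    · filter_upwards [self_mem_ae_restrict measurableSet_Ioi] with ψ hψ
      have : (0 : ℝ) < ψ := hψ
      positivity
    · filter_upwards [hlim.eventually_lt_const (lt_add_one _)] with n hn
      exact (hle n).trans hn.le
  refine ⟨hint₁, ?_⟩
  have := le_of_tendsto_of_tendsto (hcov.integral_tendsto_of_countably_generated hint₁) hlim
    (Eventually.of_forall hle)
  simpa using this

/-- The one-dimensional Sobolev (Agmon) inequality. -/
theorem sq_le_of_integral_sq_le {g g₁ : ℝ → ℝ} {a b : ℝ}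
    (hg : ∀ ψ, 0 < ψ → HasDerivAt g (g₁ ψ) ψ) (hg₁ : ContinuousOn g₁ (Ioi 0))
    (hwall : Tendsto g (𝓝[>] 0) (𝓝 0)) (ha : 0 ≤ a) (hb : 0 ≤ b)
    (hi : IntegrableOn (fun ψ => g ψ ^ 2) (Ioi 0)) (hi₁ : IntegrableOn (fun ψ => g₁ ψ ^ 2) (Ioi 0))
    (hga : ∫ ψ in Ioi (0 : ℝ), g ψ ^ 2 ≤ a ^ 2) (hgb : ∫ ψ in Ioi (0 : ℝ), g₁ ψ ^ 2 ≤ b ^ 2)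
    {ψ : ℝ} (hψ : 0 < ψ) : g ψ ^ 2 ≤ 2 * (a * b) := by
  have hgc : ContinuousOn g (Ioi 0) := fun ψ hψ => (hg ψ hψ).continuousAt.continuousWithinAt
  obtain ⟨hm', hmle⟩ := integrable_of_sq_le_mul (m := fun ψ => g ψ * g₁ ψ)
    ((hgc.mul hg₁).aestronglyMeasurable measurableSet_Ioi) hi hi₁
    (Eventually.of_forall fun _ => sq_nonneg _) (Eventually.of_forall fun _ => sq_nonneg _)
    (Eventually.of_forall fun _ => (mul_pow _ _ _).le) ha hb hga hgb
  have hm : IntegrableOn (fun ψ => g ψ * g₁ ψ) (Ioi 0) := hm'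
  have hle : ∀ δ ∈ Ioo 0 ψ, g ψ ^ 2 - g δ ^ 2 ≤ 2 * (a * b) := by
    intro δ hδ
    have hsub : Icc δ ψ ⊆ Ioi 0 := fun z hz => hδ.1.trans_le hz.1
    have h1 := intervalIntegral.integral_eq_sub_of_hasDerivAt_of_le hδ.2.le
      (f := fun z => g z ^ 2) (f' := fun z => 2 * (g z * g₁ z)) ((hgc.pow 2).mono hsub)
      (fun z hz => ((hg z (hsub (Ioo_subset_Icc_self hz))).pow 2).congr_deriv (by simp; ring))
      (((continuousOn_const.mul (hgc.mul hg₁)).mono hsub).intervalIntegrable_of_Icc hδ.2.le)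
    rw [← h1, intervalIntegral.integral_const_mul, intervalIntegral.integral_of_le hδ.2.le]
    have h2 : ∫ z in Ioc δ ψ, g z * g₁ z ≤ ∫ z in Ioc δ ψ, |g z * g₁ z| :=
      integral_mono (hm.mono_set (Ioc_subset_Icc_self.trans hsub))
        (hm.mono_set (Ioc_subset_Icc_self.trans hsub)).abs fun z => le_abs_self _
    have h3 : ∫ z in Ioc δ ψ, |g z * g₁ z| ≤ ∫ z in Ioi (0 : ℝ), |g z * g₁ z| :=
      setIntegral_mono_set hm.abs (Eventually.of_forall fun _ => abs_nonneg _)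
        (Ioc_subset_Icc_self.trans hsub).eventuallyLE
    linarith
  have ht : Tendsto (fun δ => g ψ ^ 2 - g δ ^ 2) (𝓝[>] 0) (𝓝 (g ψ ^ 2 - 0 ^ 2)) :=
    tendsto_const_nhds.sub (hwall.pow 2)
  have := le_of_tendsto ht (by
    filter_upwards [Ioo_mem_nhdsGT hψ] with δ hδ
    exact hle δ hδ)
  simpa using this

/-! ### Nondegeneracy at the wall -/

/-- On an interval where the slope of `w` is at least `m`, the weight `1 / √w` has integral at most
`2 √w / m`, which bounds the oscillation of `g'` by the degenerate energy `∫ √w (g'')²`. -/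
theorem abs_sub_le_of_slope_ge {w w₁ g₁ g₂ : ℝ → ℝ} {a ξ m D : ℝ} (haξ : a ≤ ξ)
    (hm : 0 < m) (hD : 0 ≤ D) (hw : ∀ ψ ∈ Icc a ξ, HasDerivAt w (w₁ ψ) ψ)
    (hw₁ : ContinuousOn w₁ (Icc a ξ)) (hw0 : ∀ ψ ∈ Icc a ξ, 0 < w ψ) (hwξ : w ξ ≤ 4)
    (hslope : ∀ ψ ∈ Icc a ξ, m ≤ w₁ ψ)
    (hg₁ : ∀ ψ ∈ Icc a ξ, HasDerivAt g₁ (g₂ ψ) ψ) (hg₂ : ContinuousOn g₂ (Icc a ξ))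
    (hen : ∫ ψ in Icc a ξ, √(w ψ) * g₂ ψ ^ 2 ≤ D ^ 2) :
    |g₁ a - g₁ ξ| ≤ D * √(4 / m) := by
  have hwc : ContinuousOn w (Icc a ξ) := fun ψ hψ => (hw ψ hψ).continuousAt.continuousWithinAt
  have hsc : ContinuousOn (fun ψ => √(w ψ)) (Icc a ξ) := hwc.sqrt
  have hs0 : ∀ ψ ∈ Icc a ξ, 0 < √(w ψ) := fun ψ hψ => Real.sqrt_pos.2 (hw0 ψ hψ)
  have hic : ContinuousOn (fun ψ => (√(w ψ))⁻¹) (Icc a ξ) := hsc.inv₀ fun ψ hψ => (hs0 ψ hψ).ne'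
  have hinv : ∫ ψ in Icc a ξ, (√(w ψ))⁻¹ ≤ √(4 / m) ^ 2 := by
    rw [Real.sq_sqrt (by positivity)]
    have h1 := intervalIntegral.integral_eq_sub_of_hasDerivAt_of_le haξ
      (f := fun ψ => √(w ψ)) (f' := fun ψ => w₁ ψ / (2 * √(w ψ))) hsc
      (fun ψ hψ => (hw ψ (Ioo_subset_Icc_self hψ)).sqrt (hw0 ψ (Ioo_subset_Icc_self hψ)).ne')
      ((hw₁.div (continuousOn_const.mul hsc) fun ψ hψ =>
        (mul_pos two_pos (hs0 ψ hψ)).ne').intervalIntegrable_of_Icc haξ)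
    rw [intervalIntegral.integral_of_le haξ, ← integral_Icc_eq_integral_Ioc] at h1
    have h2 : √(w ξ) ≤ 2 := by
      rw [Real.sqrt_le_left (by norm_num)]
      linarith
    have h3 : ∫ ψ in Icc a ξ, m / 2 * (√(w ψ))⁻¹ ≤ ∫ ψ in Icc a ξ, w₁ ψ / (2 * √(w ψ)) := by
      refine setIntegral_mono_on (continuousOn_const.mul hic).integrableOn_Icc
        (hw₁.div (continuousOn_const.mul hsc) fun ψ hψ =>
          (mul_pos two_pos (hs0 ψ hψ)).ne').integrableOn_Icc measurableSet_Icc fun ψ hψ => ?_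
      have := hs0 ψ hψ
      rw [div_mul_eq_mul_div, ← div_eq_mul_inv, div_div, mul_comm (√(w ψ))]
      gcongr
      exact hslope ψ hψ
    rw [integral_const_mul] at h3
    have h4 : m / 2 * ∫ ψ in Icc a ξ, (√(w ψ))⁻¹ ≤ 2 := by
      linarith [Real.sqrt_nonneg (w a)]
    rw [le_div_iff₀ hm]
    linarith
  have hpi : IntegrableOn (fun ψ => √(w ψ) * g₂ ψ ^ 2) (Icc a ξ) :=
    (hsc.mul (hg₂.pow 2)).integrableOn_Icc
  obtain ⟨hi, hle⟩ := integrable_of_sq_le_mul (μ := volume.restrict (Icc a ξ)) (m := g₂)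
    (p := fun ψ => √(w ψ) * g₂ ψ ^ 2) (q := fun ψ => (√(w ψ))⁻¹)
    (hg₂.aestronglyMeasurable measurableSet_Icc) hpi
    hic.integrableOn_Icc (Eventually.of_forall fun ψ => by positivity)
    (Eventually.of_forall fun ψ => by positivity)
    (by
      filter_upwards [self_mem_ae_restrict measurableSet_Icc] with ψ hψ
      have := (hs0 ψ hψ).ne'
      apply le_of_eq
      field_simp) hD (Real.sqrt_nonneg _) hen hinv
  have h5 := intervalIntegral.integral_eq_sub_of_hasDerivAt_of_le haξ
    (fun ψ hψ => (hg₁ ψ hψ).continuousAt.continuousWithinAt)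
    (fun ψ hψ => hg₁ ψ (Ioo_subset_Icc_self hψ)) (hg₂.intervalIntegrable_of_Icc haξ)
  rw [abs_sub_comm, ← h5, intervalIntegral.integral_of_le haξ, ← integral_Icc_eq_integral_Ioc]
  exact (abs_integral_le_integral_abs).trans hle

/-- The slope of `w = b + ε g`, started at `ξ` and followed down to the wall, cannot drop to half of
the background slope `2 m`: as long as it has not, `abs_sub_le_of_slope_ge` controls `g'`. -/
theorem abs_deriv_le_of_slope {w w₁ β g₁ g₂ : ℝ → ℝ} {ξ m D G ε : ℝ} (hξ : 0 < ξ)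
    (hm : 0 < m) (hD : 0 ≤ D) (hε : 0 < ε) (hw : ∀ ψ ∈ Ioc 0 ξ, HasDerivAt w (w₁ ψ) ψ)
    (hw₁ : ContinuousOn w₁ (Ioc 0 ξ)) (hw0 : ∀ ψ ∈ Ioc 0 ξ, 0 < w ψ) (hwξ : w ξ ≤ 4)
    (hsplit : ∀ ψ ∈ Ioc 0 ξ, w₁ ψ = β ψ + ε * g₁ ψ) (hβ : ∀ ψ ∈ Ioc 0 ξ, 2 * m ≤ β ψ)
    (hg₁ : ∀ ψ ∈ Ioc 0 ξ, HasDerivAt g₁ (g₂ ψ) ψ) (hg₂ : ContinuousOn g₂ (Ioc 0 ξ))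
    (hi : IntegrableOn (fun ψ => √(w ψ) * g₂ ψ ^ 2) (Ioi 0))
    (hen : ∫ ψ in Ioi 0, √(w ψ) * g₂ ψ ^ 2 ≤ D ^ 2) (hG : |g₁ ξ| ≤ G)
    (hsmall : ε * (G + D * √(4 / m)) < m) {ψ : ℝ} (hψ : ψ ∈ Ioc 0 ξ) :
    |g₁ ψ| ≤ G + D * √(4 / m) := by
  have key : ∀ a ∈ Ioc 0 ξ, (∀ z ∈ Icc a ξ, m ≤ w₁ z) → |g₁ a| ≤ G + D * √(4 / m) := by
    intro a ha hs
    have hsub : Icc a ξ ⊆ Ioc 0 ξ := fun z hz => ⟨ha.1.trans_le hz.1, hz.2⟩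
    have h1 := abs_sub_le_of_slope_ge ha.2 hm hD (fun z hz => hw z (hsub hz))
      (hw₁.mono hsub) (fun z hz => hw0 z (hsub hz)) hwξ hs (fun z hz => hg₁ z (hsub hz))
      (hg₂.mono hsub)
      ((setIntegral_mono_set hi (Eventually.of_forall fun z => by positivity)
        (show Icc a ξ ⊆ Ioi 0 from fun z hz => ha.1.trans_le hz.1).eventuallyLE).trans hen)
    have h2 := abs_add_le (g₁ a - g₁ ξ) (g₁ ξ)
    rw [sub_add_cancel] at h2
    linarith
  have strict : ∀ a ∈ Ioc 0 ξ, |g₁ a| ≤ G + D * √(4 / m) → m < w₁ a := by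
    intro a ha h
    have h1 := hβ a ha
    have h2 := mul_le_mul_of_nonneg_left h hε.le
    have h3 := mul_le_mul_of_nonneg_left (neg_abs_le (g₁ a)) hε.le
    rw [hsplit a ha]
    linarith
  have all : ∀ a ∈ Ioc 0 ξ, m ≤ w₁ a := by
    by_contra! hex
    obtain ⟨b, hb, hbm⟩ := hex
    have hsub : Icc b ξ ⊆ Ioc 0 ξ := fun z hz => ⟨hb.1.trans_le hz.1, hz.2⟩
    -- the last point at which the slope is at most `m`
    set S := {z ∈ Icc b ξ | w₁ z ≤ m} with hS
    have hSc : IsCompact S :=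
      isCompact_Icc.of_isClosed_subset
        ((hw₁.mono hsub).preimage_isClosed_of_isClosed isClosed_Icc isClosed_Iic)
        (fun z hz => hz.1)
    have hSn : S.Nonempty := ⟨b, ⟨le_rfl, hb.2⟩, hbm.le⟩
    obtain ⟨hc1, hc2⟩ := hSc.sSup_mem hSn
    set c := sSup S
    have hcm : w₁ c = m := by
      refine le_antisymm hc2 ?_
      by_contra! hlt
      have hcξ : c < ξ := by
        refine lt_of_le_of_ne hc1.2 fun h => ?_
        have := strict ξ ⟨hξ, le_rfl⟩ (hG.trans (by
          have := mul_nonneg hD (Real.sqrt_nonneg (4 / m))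
          linarith))
        rw [h] at hlt
        linarith
      have hcont : ContinuousWithinAt w₁ (Ioc c ξ) c :=
        (hw₁ c (hsub hc1)).mono fun z hz => hsub ⟨hc1.1.trans hz.1.le, hz.2⟩
      have hev := hcont.eventually_lt_const hlt
      rw [nhdsWithin_Ioc_eq_nhdsGT hcξ] at hev
      obtain ⟨z, hz1, hz2, hz3⟩ := (hev.and (Ioo_mem_nhdsGT hcξ)).exists
      exact absurd (le_csSup hSc.bddAbove
        (show z ∈ S from ⟨⟨hc1.1.trans hz2.le, hz3.le⟩, hz1.le⟩)) (not_le.2 hz2)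
    have := strict c (hsub hc1) (key c (hsub hc1) fun z hz => by
      rcases hz.1.eq_or_lt with h | h
      · rw [← h, hcm]
      · by_contra! hlt
        exact absurd (le_csSup hSc.bddAbove
          (show z ∈ S from ⟨⟨hc1.1.trans hz.1, hz.2⟩, hlt.le⟩)) (not_le.2 h))
    linarith
  exact key ψ hψ fun z hz => all z ⟨hψ.1.trans_le hz.1, hz.2⟩

/-! ### Estimates at a fixed time -/

/-- A perturbation at one time `x`, with `t = (x + 1) ^ (1 / 4)`: the functions `g`, `g₁`, `g₂`, `k`
stand for `φ`, `φ_ψ`, `φ_ψψ`, `φ_x`, and `a` for the coefficient `A`.  The number `N` bounds the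
norm of `φ`, and `q = (x + 1) ^ σ₁` is the loss allowed in the decay of `φ_x`. -/
structure Slice (f : ℝ → ℝ) (ε t q N : ℝ) (g g₁ g₂ k a : ℝ → ℝ) : Prop where
  eps_pos : 0 < ε
  one_le_t : 1 ≤ t
  one_le_q : 1 ≤ q
  q_le_t : q ≤ t
  N_nonneg : 0 ≤ N
  hasDeriv : ∀ ψ, 0 < ψ → HasDerivAt g (g₁ ψ) ψ
  hasDeriv₁ : ∀ ψ, 0 < ψ → HasDerivAt g₁ (g₂ ψ) ψ
  cont₂ : ContinuousOn g₂ (Ioi 0)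
  wall : Tendsto g (𝓝[>] 0) (𝓝 0)
  wall₁ : ∃ L, Tendsto g₁ (𝓝[>] 0) (𝓝 L)
  far : Tendsto g atTop (𝓝 0)
  pos : ∀ ψ, 0 < ψ → 0 < sqProfile f (ψ / t ^ 2) + ε * g ψ
  coeff_nonneg : ∀ ψ, 0 < ψ → 0 ≤ a ψ
  coeff_le : ∀ ψ, 0 < ψ → a ψ ≤ 2 / t ^ 4
  eqn : ∀ ψ, 0 < ψ → √(sqProfile f (ψ / t ^ 2) + ε * g ψ) * g₂ ψ = k ψ + a ψ * g ψ
  int : IntegrableOn (fun ψ => g ψ ^ 2) (Ioi 0)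
  int_le : ∫ ψ in Ioi (0 : ℝ), g ψ ^ 2 ≤ N ^ 2
  intw : IntegrableOn (fun ψ => g ψ ^ 2 * (1 + ψ) / √(sqProfile f (ψ / t ^ 2) + ε * g ψ)) (Ioi 0)
  intw_le : ∫ ψ in Ioi (0 : ℝ),
    g ψ ^ 2 * (1 + ψ) / √(sqProfile f (ψ / t ^ 2) + ε * g ψ) ≤ N ^ 2
  intk : IntegrableOn (fun ψ => k ψ ^ 2 * (1 + ψ) / √(sqProfile f (ψ / t ^ 2) + ε * g ψ)) (Ioi 0)
  intk_le : ∫ ψ in Ioi (0 : ℝ),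
    k ψ ^ 2 * (1 + ψ) / √(sqProfile f (ψ / t ^ 2) + ε * g ψ) ≤ (N * q / t ^ 4) ^ 2

namespace Slice

variable {f : ℝ → ℝ} {ε t q N : ℝ} {g g₁ g₂ k a : ℝ → ℝ}

theorem t_pos (h : Slice f ε t q N g g₁ g₂ k a) : 0 < t := one_pos.trans_le h.one_le_t

theorem q_pos (h : Slice f ε t q N g g₁ g₂ k a) : 0 < q := one_pos.trans_le h.one_le_q

theorem cont (h : Slice f ε t q N g g₁ g₂ k a) : ContinuousOn g (Ioi 0) := fun ψ hψ =>
  (h.hasDeriv ψ hψ).continuousAt.continuousWithinAt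

theorem cont₁ (h : Slice f ε t q N g g₁ g₂ k a) : ContinuousOn g₁ (Ioi 0) := fun ψ hψ =>
  (h.hasDeriv₁ ψ hψ).continuousAt.continuousWithinAt

theorem hasDerivAt_sq_vel (h : Slice f ε t q N g g₁ g₂ k a) (hf : IsBlasiusProfile f) {ψ : ℝ}
    (hψ : 0 < ψ) : HasDerivAt (fun ψ => sqProfile f (ψ / t ^ 2) + ε * g ψ)
      (2 * shearProfile f (ψ / t ^ 2) / t ^ 2 + ε * g₁ ψ) ψ := by
  have ht := h.t_pos
  have h1 := (hf.hasDerivAt_sqProfile (show 0 < ψ / t ^ 2 by positivity)).comp ψ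
    ((hasDerivAt_id ψ).div_const (t ^ 2))
  exact (h1.congr_deriv (mul_one_div _ _)).add ((h.hasDeriv ψ hψ).const_mul ε)

theorem cont_sq_vel (h : Slice f ε t q N g g₁ g₂ k a) (hf : IsBlasiusProfile f) :
    ContinuousOn (fun ψ => sqProfile f (ψ / t ^ 2) + ε * g ψ) (Ioi 0) := fun _ hψ =>
  (h.hasDerivAt_sq_vel hf hψ).continuousAt.continuousWithinAt

/-- The equation turns the bound on `φ_x` into one on `φ_ψψ`, in the space weighted by `u`. -/
theorem energy₂ (h : Slice f ε t q N g g₁ g₂ k a) (hf : IsBlasiusProfile f) :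
    IntegrableOn (fun ψ => √(sqProfile f (ψ / t ^ 2) + ε * g ψ) * g₂ ψ ^ 2 * (1 + ψ)) (Ioi 0) ∧
      ∫ ψ in Ioi (0 : ℝ), √(sqProfile f (ψ / t ^ 2) + ε * g ψ) * g₂ ψ ^ 2 * (1 + ψ)
        ≤ (4 * N * q / t ^ 4) ^ 2 := by
  have ht := h.t_pos
  have hdom := (h.intk.const_mul 2).add (h.intw.const_mul (2 * (2 / t ^ 4) ^ 2))
  have hle : ∀ ψ ∈ Ioi (0 : ℝ), √(sqProfile f (ψ / t ^ 2) + ε * g ψ) * g₂ ψ ^ 2 * (1 + ψ)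
      ≤ 2 * (k ψ ^ 2 * (1 + ψ) / √(sqProfile f (ψ / t ^ 2) + ε * g ψ))
        + 2 * (2 / t ^ 4) ^ 2 *
          (g ψ ^ 2 * (1 + ψ) / √(sqProfile f (ψ / t ^ 2) + ε * g ψ)) := by
    intro ψ hψ
    have hu := Real.sqrt_pos.2 (h.pos ψ hψ)
    have he := h.eqn ψ hψ
    set u := √(sqProfile f (ψ / t ^ 2) + ε * g ψ)
    have hψ' : (0 : ℝ) < ψ := hψ
    have h1 : u * g₂ ψ ^ 2 * (1 + ψ) = (k ψ + a ψ * g ψ) ^ 2 * (1 + ψ) / u := by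
      rw [← he]
      field_simp
    have h2 : (a ψ * g ψ) ^ 2 ≤ (2 / t ^ 4) ^ 2 * g ψ ^ 2 := by
      rw [mul_pow]
      gcongr
      · exact h.coeff_nonneg ψ hψ
      · exact h.coeff_le ψ hψ
    have h3 : (k ψ + a ψ * g ψ) ^ 2 ≤ 2 * k ψ ^ 2 + 2 * ((2 / t ^ 4) ^ 2 * g ψ ^ 2) := by
      nlinarith [sq_nonneg (k ψ - a ψ * g ψ)]
    rw [h1]
    calc (k ψ + a ψ * g ψ) ^ 2 * (1 + ψ) / u
        ≤ (2 * k ψ ^ 2 + 2 * ((2 / t ^ 4) ^ 2 * g ψ ^ 2)) * (1 + ψ) / u := by gcongr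
      _ = _ := by ring
  have hcu := (h.cont_sq_vel hf).sqrt
  have hint : IntegrableOn
      (fun ψ => √(sqProfile f (ψ / t ^ 2) + ε * g ψ) * g₂ ψ ^ 2 * (1 + ψ)) (Ioi 0) := by
    refine hdom.mono' (((hcu.mul (h.cont₂.pow 2)).mul
      (by fun_prop : ContinuousOn (fun ψ : ℝ => 1 + ψ) (Ioi 0))).aestronglyMeasurable
        measurableSet_Ioi) ?_
    filter_upwards [self_mem_ae_restrict measurableSet_Ioi] with ψ hψ
    have hψ' : (0 : ℝ) < ψ := hψ
    rw [Real.norm_of_nonneg (by positivity)]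
    exact hle ψ hψ
  refine ⟨hint, (setIntegral_mono_on hint hdom measurableSet_Ioi hle).trans ?_⟩
  refine (integral_add (h.intk.const_mul 2) (h.intw.const_mul (2 * (2 / t ^ 4) ^ 2))).le.trans ?_
  rw [integral_const_mul, integral_const_mul]
  have h1 := h.intk_le
  have h2 : 2 * (2 / t ^ 4) ^ 2 * ∫ ψ in Ioi (0 : ℝ),
      g ψ ^ 2 * (1 + ψ) / √(sqProfile f (ψ / t ^ 2) + ε * g ψ)
      ≤ 2 * (2 / t ^ 4) ^ 2 * N ^ 2 := by
    gcongr
    exact h.intw_le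
  have h3 : N ^ 2 * 1 ^ 2 / (t ^ 4) ^ 2 ≤ N ^ 2 * q ^ 2 / (t ^ 4) ^ 2 := by
    gcongr
    exact h.one_le_q
  have h4 : 2 * (2 / t ^ 4) ^ 2 * N ^ 2 = 8 * (N ^ 2 * 1 ^ 2 / (t ^ 4) ^ 2) := by ring
  have h5 : (4 * N * q / t ^ 4) ^ 2 = 16 * (N ^ 2 * q ^ 2 / (t ^ 4) ^ 2) := by ring
  have h6 : (N * q / t ^ 4) ^ 2 = N ^ 2 * q ^ 2 / (t ^ 4) ^ 2 := by ring
  have h7 : 0 ≤ N ^ 2 * q ^ 2 / (t ^ 4) ^ 2 := by positivity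
  rw [h6] at h1
  linarith

theorem integrable_mul₂ (h : Slice f ε t q N g g₁ g₂ k a) (hf : IsBlasiusProfile f) :
    IntegrableOn (fun ψ => g ψ * g₂ ψ * (1 + ψ)) (Ioi 0) ∧
      ∫ ψ in Ioi (0 : ℝ), |g ψ * g₂ ψ * (1 + ψ)| ≤ N * (4 * N * q / t ^ 4) := by
  have ht := h.t_pos
  have hq := h.q_pos
  have hN := h.N_nonneg
  obtain ⟨hi, hle⟩ := h.energy₂ hf
  refine integrable_of_sq_le_mul (((h.cont.mul h.cont₂).mul
      (by fun_prop : ContinuousOn (fun ψ : ℝ => 1 + ψ) (Ioi 0))).aestronglyMeasurable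
        measurableSet_Ioi) h.intw hi ?_ ?_ ?_ hN (by positivity) h.intw_le hle
  all_goals
    filter_upwards [self_mem_ae_restrict measurableSet_Ioi] with ψ hψ
    have hψ' : (0 : ℝ) < ψ := hψ
  · positivity
  · positivity
  · have hu := (Real.sqrt_pos.2 (h.pos ψ hψ)).ne'
    generalize √(sqProfile f (ψ / t ^ 2) + ε * g ψ) = u at hu ⊢
    apply le_of_eq
    field_simp

theorem integral_sq_deriv (h : Slice f ε t q N g g₁ g₂ k a) (hf : IsBlasiusProfile f) :
    IntegrableOn (fun ψ => g₁ ψ ^ 2 * (1 + ψ)) (Ioi 0) ∧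
      ∫ ψ in Ioi (0 : ℝ), g₁ ψ ^ 2 * (1 + ψ) ≤ -∫ ψ in Ioi (0 : ℝ), g ψ * g₂ ψ * (1 + ψ) := by
  obtain ⟨L, hL⟩ := h.wall₁
  exact integral_sq_deriv_mul_le h.hasDeriv h.hasDeriv₁ h.cont₂ h.wall hL h.far
    (h.integrable_mul₂ hf).1

/-- The heat-flow decay of `φ` in `L^∞`, up to the loss `q`. -/
theorem abs_le (h : Slice f ε t q N g g₁ g₂ k a) (hf : IsBlasiusProfile f) {ψ : ℝ} (hψ : 0 < ψ) :
    |g ψ| ≤ 2 * N * q / t := by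
  have ht := h.t_pos
  have hq := h.q_pos
  have hN := h.N_nonneg
  obtain ⟨hi, hle⟩ := h.integral_sq_deriv hf
  obtain ⟨hj, hjle⟩ := h.integrable_mul₂ hf
  have hi' : IntegrableOn (fun ψ => g₁ ψ ^ 2) (Ioi 0) := by
    refine hi.mono' ((h.cont₁.pow 2).aestronglyMeasurable measurableSet_Ioi) ?_
    filter_upwards [self_mem_ae_restrict measurableSet_Ioi] with ψ hψ
    have hψ' : (0 : ℝ) < ψ := hψ
    rw [Real.norm_of_nonneg (sq_nonneg _)]
    nlinarith [sq_nonneg (g₁ ψ)]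
  have h1 : ∫ ψ in Ioi (0 : ℝ), g₁ ψ ^ 2 ≤ (2 * N * q / t ^ 2) ^ 2 := by
    have h2 : ∫ ψ in Ioi (0 : ℝ), g₁ ψ ^ 2 ≤ ∫ ψ in Ioi (0 : ℝ), g₁ ψ ^ 2 * (1 + ψ) :=
      setIntegral_mono_on hi' hi measurableSet_Ioi fun ψ hψ => by
        have hψ' : (0 : ℝ) < ψ := hψ
        nlinarith [sq_nonneg (g₁ ψ)]
    have h3 := neg_abs_le (∫ ψ in Ioi (0 : ℝ), g ψ * g₂ ψ * (1 + ψ))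
    have h4 : |∫ ψ in Ioi (0 : ℝ), g ψ * g₂ ψ * (1 + ψ)|
        ≤ ∫ ψ in Ioi (0 : ℝ), |g ψ * g₂ ψ * (1 + ψ)| := abs_integral_le_integral_abs
    have h5 : N * (4 * N * q / t ^ 4) ≤ (2 * N * q / t ^ 2) ^ 2 := by
      have : N * (4 * N * q / t ^ 4) = 4 * N ^ 2 * (q * 1) / t ^ 4 := by ring
      rw [this]
      have : (2 * N * q / t ^ 2) ^ 2 = 4 * N ^ 2 * (q * q) / t ^ 4 := by ring
      rw [this]
      gcongr
      exact h.one_le_q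
    linarith
  have h2 := sq_le_of_integral_sq_le h.hasDeriv h.cont₁ h.wall hN (by positivity) h.int hi'
    h.int_le h1 hψ
  refine abs_le_of_sq_le_sq (h2.trans ?_) (by positivity)
  have h3 : 2 * (N * (2 * N * q / t ^ 2)) = 4 * N ^ 2 * (q * 1) / t ^ 2 := by ring
  have h4 : (2 * N * q / t) ^ 2 = 4 * N ^ 2 * (q * q) / t ^ 2 := by ring
  rw [h3, h4]
  gcongr
  exact h.one_le_q

/-- The mean value theorem on `(t² / 2, t²)`. -/
theorem exists_abs_deriv_le (h : Slice f ε t q N g g₁ g₂ k a) (hf : IsBlasiusProfile f) :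
    ∃ ξ, t ^ 2 / 2 < ξ ∧ ξ < t ^ 2 ∧ |g₁ ξ| ≤ 8 * N * q / t ^ 3 := by
  have ht := h.t_pos
  have hr : 0 < t ^ 2 := by positivity
  have hsub : Icc (t ^ 2 / 2) (t ^ 2) ⊆ Ioi 0 := fun z hz => (by
    have := hz.1
    exact mem_Ioi.2 (by linarith))
  obtain ⟨ξ, hξ, he⟩ := exists_hasDerivAt_eq_slope g g₁ (show t ^ 2 / 2 < t ^ 2 by linarith)
    (h.cont.mono hsub) (fun z hz => h.hasDeriv z (hsub (Ioo_subset_Icc_self hz)))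
  refine ⟨ξ, hξ.1, hξ.2, ?_⟩
  have h1 := h.abs_le hf hr
  have h2 := h.abs_le hf (half_pos hr)
  rw [he, abs_div, abs_of_pos (show 0 < t ^ 2 - t ^ 2 / 2 by linarith), div_le_iff₀ (by linarith)]
  calc |g (t ^ 2) - g (t ^ 2 / 2)| ≤ |g (t ^ 2)| + |g (t ^ 2 / 2)| := abs_sub _ _
    _ ≤ 2 * N * q / t + 2 * N * q / t := add_le_add h1 h2
    _ = 8 * N * q / t ^ 3 * (t ^ 2 - t ^ 2 / 2) := by
      field_simp
      ring

end Slice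

/-- The constant in the bound of `φ_ψ` near the wall; `c` is the slope of `ū²`. -/
noncomputable def wallConst (c : ℝ) : ℝ := 8 + 4 * √(8 / c)

/-- The constant in the bound of `φ / ū²`; `c` is the slope of `ū²`. -/
noncomputable def ratioConst (c : ℝ) : ℝ := (wallConst c + 4) / c

theorem wallConst_pos (c : ℝ) : 0 < wallConst c := by
  rw [wallConst]
  positivity

namespace Slice

variable {f : ℝ → ℝ} {ε t q N : ℝ} {g g₁ g₂ k a : ℝ → ℝ}

/-- `φ_ψ` is bounded up to the wall, with the scaling of the heat flow. -/
theorem abs_deriv_le (h : Slice f ε t q N g g₁ g₂ k a) (hf : IsBlasiusProfile f) {c M : ℝ}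
    (hc : c = 2 * shearProfile f 1) (hNM : N ≤ M) (hε₁ : ε * (2 * M) ≤ 3)
    (hε₂ : ε * (wallConst c * M) < c / 2) :
    ∃ ξ, t ^ 2 / 2 < ξ ∧ ξ < t ^ 2 ∧
      ∀ ψ, 0 < ψ → ψ ≤ ξ → |g₁ ψ| ≤ wallConst c * N * q / t ^ 3 := by
  have ht := h.t_pos
  have hq := h.q_pos
  have hN := h.N_nonneg
  have hε := h.eps_pos
  have hc0 : 0 < c := by
    have := hf.shearProfile_pos one_pos
    rw [hc]
    positivity
  have hqt : q / t ≤ 1 := (div_le_one ht).2 h.q_le_t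
  obtain ⟨ξ, hξ1, hξ2, hξ⟩ := h.exists_abs_deriv_le hf
  have hξ0 : 0 < ξ := lt_trans (by positivity) hξ1
  refine ⟨ξ, hξ1, hξ2, fun ψ hψ hψξ => ?_⟩
  obtain ⟨hi, hle⟩ := h.energy₂ hf
  have hcu := (h.cont_sq_vel hf).sqrt
  have hsub : Ioc 0 ξ ⊆ Ioi 0 := fun z hz => hz.1
  have hi' : IntegrableOn (fun ψ => √(sqProfile f (ψ / t ^ 2) + ε * g ψ) * g₂ ψ ^ 2) (Ioi 0) := by
    refine hi.mono' ((hcu.mul (h.cont₂.pow 2)).aestronglyMeasurable measurableSet_Ioi) ?_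
    filter_upwards [self_mem_ae_restrict measurableSet_Ioi] with z hz
    have hz' : (0 : ℝ) < z := hz
    rw [Real.norm_of_nonneg (by positivity)]
    exact le_mul_of_one_le_right (by positivity) (by linarith)
  have hle' : ∫ ψ in Ioi (0 : ℝ), √(sqProfile f (ψ / t ^ 2) + ε * g ψ) * g₂ ψ ^ 2
      ≤ (4 * N * q / t ^ 4) ^ 2 :=
    (setIntegral_mono_on hi' hi measurableSet_Ioi fun z hz => by
      have hz' : (0 : ℝ) < z := hz
      exact le_mul_of_one_le_right (by positivity) (by linarith)).trans hle
  have hwξ : sqProfile f (ξ / t ^ 2) + ε * g ξ ≤ 4 := by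
    have h1 := hf.sqProfile_le_one (show 0 < ξ / t ^ 2 by positivity)
    have h2 : ε * g ξ ≤ ε * (2 * M) := by
      refine mul_le_mul_of_nonneg_left ?_ hε.le
      calc g ξ ≤ 2 * N * q / t := (le_abs_self _).trans (h.abs_le hf hξ0)
        _ = 2 * N * (q / t) := by ring
        _ ≤ 2 * N * 1 := by gcongr
        _ ≤ 2 * M := by linarith
    linarith
  have hsum : 8 * N * q / t ^ 3 + 4 * N * q / t ^ 4 * √(4 / (c / (2 * t ^ 2)))
      = wallConst c * N * q / t ^ 3 := by
    have : 4 / (c / (2 * t ^ 2)) = 8 / c * t ^ 2 := by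
      field_simp
      norm_num
    rw [this, Real.sqrt_mul (by positivity), Real.sqrt_sq ht.le, wallConst]
    field_simp
  rw [← hsum]
  refine abs_deriv_le_of_slope (w := fun ψ => sqProfile f (ψ / t ^ 2) + ε * g ψ)
    (w₁ := fun ψ => 2 * shearProfile f (ψ / t ^ 2) / t ^ 2 + ε * g₁ ψ)
    (β := fun ψ => 2 * shearProfile f (ψ / t ^ 2) / t ^ 2) hξ0
    (show 0 < c / (2 * t ^ 2) by positivity) (by positivity) hε
    (fun z hz => h.hasDerivAt_sq_vel hf hz.1) ?_ (fun z hz => h.pos z hz.1) hwξ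
    (fun z _ => rfl) (fun z hz => ?_) (fun z hz => h.hasDeriv₁ z hz.1) (h.cont₂.mono hsub) hi' hle'
    hξ ?_ ⟨hψ, hψξ⟩
  · have h1 : ContinuousOn (fun ψ => shearProfile f (ψ / t ^ 2)) (Ioc 0 ξ) :=
      hf.continuousOn_shearProfile.comp (by fun_prop) fun z hz => mem_Ioi.2 (by
        have := hz.1
        positivity)
    exact ((continuousOn_const.mul h1).div_const _).add
      (continuousOn_const.mul (h.cont₁.mono hsub))
  · have hz0 : 0 < z := hz.1
    have h1 : shearProfile f 1 ≤ shearProfile f (z / t ^ 2) :=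
      hf.antitoneOn_shearProfile (mem_Ioi.2 (by positivity)) (mem_Ioi.2 one_pos)
        ((div_le_one (by positivity)).2 (hz.2.trans hξ2.le))
    have h2 : 2 * (c / (2 * t ^ 2)) = 2 * shearProfile f 1 / t ^ 2 := by
      rw [hc]
      field_simp
    rw [h2]
    gcongr
  · rw [hsum, lt_div_iff₀ (by positivity)]
    have h1 := wallConst_pos c
    calc ε * (wallConst c * N * q / t ^ 3) * (2 * t ^ 2)
        = 2 * (ε * (wallConst c * N) * (q / t)) := by
          field_simp
      _ ≤ 2 * (ε * (wallConst c * N) * 1) := by gcongr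
      _ ≤ 2 * (ε * (wallConst c * M)) := by
          rw [mul_one]
          gcongr
      _ < c := by linarith

theorem abs_le_mul_sqProfile (h : Slice f ε t q N g g₁ g₂ k a) (hf : IsBlasiusProfile f) {c M : ℝ}
    (hc : c = 2 * shearProfile f 1) (hNM : N ≤ M) (hε₁ : ε * (2 * M) ≤ 3)
    (hε₂ : ε * (wallConst c * M) < c / 2) {ψ : ℝ} (hψ : 0 < ψ) :
    |g ψ| ≤ ratioConst c * N * (q / t) * sqProfile f (ψ / t ^ 2) := by
  have ht := h.t_pos
  have hq := h.q_pos
  have hN := h.N_nonneg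
  have hW := wallConst_pos c
  have hc0 : 0 < c := by
    have := hf.shearProfile_pos one_pos
    rw [hc]
    positivity
  obtain ⟨ξ, hξ1, hξ2, hξ⟩ := h.abs_deriv_le hf hc hNM hε₁ hε₂
  have hs0 : 0 < ψ / t ^ 2 := by positivity
  rcases le_or_gt ψ ξ with hle | hlt
  · -- near the wall: `φ` is at most `ψ` times its Lipschitz constant, and `ū²` at least `c ψ / t²`
    have hlip : |g ψ| ≤ wallConst c * N * q / t ^ 3 * ψ := by
      have h1 : ∀ δ ∈ Ioo 0 ψ, |g ψ - g δ| ≤ wallConst c * N * q / t ^ 3 * ψ := by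
        intro δ hδ
        have h2 := Convex.norm_image_sub_le_of_norm_hasDerivWithin_le (s := Icc δ ψ)
          (fun z hz => (h.hasDeriv z (hδ.1.trans_le hz.1)).hasDerivWithinAt)
          (fun z hz => hξ z (hδ.1.trans_le hz.1) (hz.2.trans hle)) (convex_Icc _ _)
          (left_mem_Icc.2 hδ.2.le) (right_mem_Icc.2 hδ.2.le)
        rw [Real.norm_eq_abs, Real.norm_eq_abs, abs_of_pos (sub_pos.2 hδ.2)] at h2
        refine h2.trans ?_
        gcongr
        linarith [hδ.1]
      have h3 : Tendsto (fun δ => |g ψ - g δ|) (𝓝[>] 0) (𝓝 |g ψ - 0|) :=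
        (tendsto_const_nhds.sub h.wall).abs
      rw [sub_zero] at h3
      exact le_of_tendsto h3 (by
        filter_upwards [Ioo_mem_nhdsGT hψ] with δ hδ
        exact h1 δ hδ)
    have hB := hf.le_sqProfile_of_le_one hs0 ((div_le_one (by positivity)).2 (hle.trans hξ2.le))
    rw [← hc] at hB
    calc |g ψ| ≤ wallConst c * N * q / t ^ 3 * ψ := hlip
      _ = wallConst c / c * N * (q / t) * (c * (ψ / t ^ 2)) := by field_simp
      _ ≤ ratioConst c * N * (q / t) * sqProfile f (ψ / t ^ 2) := by
        rw [ratioConst]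
        gcongr
        linarith
  · have hB : c / 2 ≤ sqProfile f (ψ / t ^ 2) := by
      have h1 := hf.le_sqProfile_of_le_one (show (0 : ℝ) < 1 / 2 by norm_num) (by norm_num)
      have h2 := hf.monotoneOn_sqProfile (mem_Ioi.2 (show (0 : ℝ) < 1 / 2 by norm_num))
        (mem_Ioi.2 hs0) (by
          rw [le_div_iff₀ (by positivity)]
          linarith)
      rw [← hc] at h1
      linarith
    calc |g ψ| ≤ 2 * N * q / t := h.abs_le hf hψ
      _ = 4 / c * N * (q / t) * (c / 2) := by
        field_simp
        ring
      _ ≤ ratioConst c * N * (q / t) * sqProfile f (ψ / t ^ 2) := by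
        rw [ratioConst]
        gcongr
        linarith

end Slice

/-! ### From the norm of a solution to bounds at a fixed time -/

theorem hasDerivAt_iteratedDeriv_of_contDiffOn {h : ℝ → ℝ} (hh : ContDiffOn ℝ ∞ h (Ioi 0)) (k : ℕ)
    {z : ℝ} (hz : 0 < z) : HasDerivAt (iteratedDeriv k h) (iteratedDeriv (k + 1) h z) z := by
  have h1 : DifferentiableOn ℝ (iteratedDerivWithin k h (Ioi 0)) (Ioi 0) :=
    hh.differentiableOn_iteratedDerivWithin (by exact_mod_cast WithTop.coe_lt_top k)
      isOpen_Ioi.uniqueDiffOn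
  have h2 : DifferentiableOn ℝ (iteratedDeriv k h) (Ioi 0) :=
    h1.congr fun y hy => (iteratedDerivWithin_of_isOpen isOpen_Ioi hy).symm
  have h3 := (h2.differentiableAt (Ioi_mem_nhds hz)).hasDerivAt
  rwa [← iteratedDeriv_succ] at h3

theorem integral_sq_le_of_eLpNorm_le {α : Type*} [MeasurableSpace α] {μ : Measure α} {h : α → ℝ}
    {N : ℝ} (hh : AEStronglyMeasurable h μ) (hN : 0 ≤ N)
    (hle : eLpNorm h 2 μ ≤ ENNReal.ofReal N) :
    Integrable (fun z => h z ^ 2) μ ∧ ∫ z, h z ^ 2 ∂μ ≤ N ^ 2 := by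
  have hm : MemLp h 2 μ := ⟨hh, hle.trans_lt ENNReal.ofReal_lt_top⟩
  refine ⟨hm.integrable_sq, ?_⟩
  have h1 := hm.eLpNorm_eq_integral_rpow_norm (by norm_num) (by norm_num)
  rw [h1, ENNReal.ofReal_le_ofReal_iff hN] at hle
  simp only [ENNReal.toReal_ofNat, Real.rpow_two, Real.norm_eq_abs, sq_abs] at hle
  rw [← one_div, ← Real.sqrt_eq_rpow, Real.sqrt_le_left hN] at hle
  exact hle

/-- A solution of norm at most `M`, with the smallness conditions on `ε` under which the slope of
`u²` at the wall stays comparable to that of `ū²`. -/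
structure IsSmallSolution (f : ℝ → ℝ) (ε : ℝ) (K : ℕ) (σ : ℕ → ℝ) (M : ℝ) (φ : ℝ → ℝ → ℝ) :
    Prop where
  blasius : IsBlasiusProfile f
  eps_pos : 0 < ε
  two_le : 2 ≤ K
  sol : IsSolution f ε K φ
  norm_le : normX f ε σ K φ ≤ ENNReal.ofReal M
  M_pos : 0 < M
  sigma_zero : σ 0 = 0
  sigma_one_pos : 0 < σ 1
  sigma_one_le : σ 1 ≤ 1 / 16
  sigma_two_le : σ 2 ≤ 1 / 16
  small₁ : ε * (2 * M) ≤ 3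
  small₂ : ε * (wallConst (2 * shearProfile f 1) * M) < 2 * shearProfile f 1 / 2
  small₃ : ε * (ratioConst (2 * shearProfile f 1) * M) ≤ 3 / 4

namespace IsSmallSolution

variable {f : ℝ → ℝ} {ε : ℝ} {K : ℕ} {σ : ℕ → ℝ} {M : ℝ} {φ : ℝ → ℝ → ℝ}

theorem norm_toReal_le (h : IsSmallSolution f ε K σ M φ) : (normX f ε σ K φ).toReal ≤ M :=
  ENNReal.toReal_le_of_le_ofReal h.M_pos.le h.norm_le

theorem ofReal_norm (h : IsSmallSolution f ε K σ M φ) :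
    ENNReal.ofReal (normX f ε σ K φ).toReal = normX f ε σ K φ :=
  ENNReal.ofReal_toReal (h.norm_le.trans_lt ENNReal.ofReal_lt_top).ne

theorem normXk_le (h : IsSmallSolution f ε K σ M φ) {k : ℕ} (hk : k ≤ K) :
    normXk f ε σ φ k ≤ ENNReal.ofReal (normX f ε σ K φ).toReal := by
  rw [h.ofReal_norm]
  exact Finset.single_le_sum (f := fun k => normXk f ε σ φ k) (fun _ _ => zero_le)
    (Finset.mem_range.2 (Nat.lt_succ_of_le hk))

theorem hasDerivAt_dx (h : IsSmallSolution f ε K σ M φ) (k : ℕ) {x ψ : ℝ} (hx : 0 < x)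
    (hψ : 0 < ψ) : HasDerivAt (fun x => dx k φ x ψ) (dx (k + 1) φ x ψ) x := by
  have h1 : ContDiffOn ℝ ∞ (fun x => φ x ψ) (Ioi 0) :=
    h.sol.smooth.comp (f := fun x : ℝ => (x, ψ)) (by fun_prop) fun x hx => ⟨hx, hψ⟩
  exact hasDerivAt_iteratedDeriv_of_contDiffOn h1 k hx

theorem dx_zero (φ : ℝ → ℝ → ℝ) : dx 0 φ = φ := by
  funext x ψ
  simp [dx]

theorem contDiffOn_slice (h : IsSmallSolution f ε K σ M φ) {x : ℝ} (hx : 0 < x) :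
    ContDiffOn ℝ ∞ (φ x) (Ioi 0) :=
  h.sol.smooth.comp (f := fun ψ : ℝ => (x, ψ)) (by fun_prop) fun _ hψ => ⟨hx, hψ⟩

theorem continuousOn_dx (h : IsSmallSolution f ε K σ M φ) {k : ℕ} (hk : k ≤ K) {x : ℝ}
    (hx : 0 < x) : ContinuousOn (dx k φ x) (Ici 0) :=
  (h.sol.continuous_dx k hk).comp (f := fun ψ : ℝ => (x, ψ)) (by fun_prop)
    fun _ hψ => ⟨hx, hψ⟩

theorem vel_eq (h : IsSmallSolution f ε K σ M φ) {x ψ : ℝ} (hx : 0 < x) (hψ : 0 < ψ) :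
    vel f ε φ x ψ = √(sqProfile f (ψ / √(x + 1)) + ε * φ x ψ) := by
  rw [vel, h.blasius.ubar_sq hx hψ]

theorem sq_vel_pos (h : IsSmallSolution f ε K σ M φ) {x ψ : ℝ} (hx : 0 < x) (hψ : 0 < ψ) :
    0 < sqProfile f (ψ / √(x + 1)) + ε * φ x ψ := by
  rw [← h.blasius.ubar_sq hx hψ]
  exact h.sol.pos x ψ hx hψ

theorem vel_pos (h : IsSmallSolution f ε K σ M φ) {x ψ : ℝ} (hx : 0 < x) (hψ : 0 < ψ) :
    0 < vel f ε φ x ψ := by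
  rw [h.vel_eq hx hψ]
  exact Real.sqrt_pos.2 (h.sq_vel_pos hx hψ)

theorem vel_sq (h : IsSmallSolution f ε K σ M φ) {x ψ : ℝ} (hx : 0 < x) (hψ : 0 < ψ) :
    vel f ε φ x ψ ^ 2 = sqProfile f (ψ / √(x + 1)) + ε * φ x ψ := by
  rw [h.vel_eq hx hψ, Real.sq_sqrt (h.sq_vel_pos hx hψ).le]

theorem continuousOn_vel (h : IsSmallSolution f ε K σ M φ) {x : ℝ} (hx : 0 < x) :
    ContinuousOn (vel f ε φ x) (Ioi 0) := by
  have hr : 0 < √(x + 1) := Real.sqrt_pos.2 (by linarith)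
  have h1 : ContinuousOn (fun ψ => sqProfile f (ψ / √(x + 1))) (Ioi 0) := fun ψ hψ => by
    have hs : 0 < ψ / √(x + 1) := div_pos hψ hr
    exact (ContinuousAt.comp (f := fun ψ => ψ / √(x + 1)) (g := sqProfile f)
      (h.blasius.hasDerivAt_sqProfile hs).continuousAt (by fun_prop)).continuousWithinAt
  exact ((h1.add (continuousOn_const.mul (h.contDiffOn_slice hx).continuousOn)).sqrt).congr
    fun ψ hψ => h.vel_eq hx hψ

theorem ubar_add_eps_rho (h : IsSmallSolution f ε K σ M φ) (x ψ : ℝ) :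
    ubar f x ψ + ε * rho f ε φ x ψ = vel f ε φ x ψ := by
  rw [rho, mul_div_cancel₀ _ h.eps_pos.ne']
  ring

/-- The weighted norm of `∂ₓᵏ φ` at one time, with the weight `⟨ψ⟩ ≤ ⟨√ψ⟩²`. -/
theorem integral_dx_sq_le (h : IsSmallSolution f ε K σ M φ) {k : ℕ} (hk : k ≤ K) {x : ℝ}
    (hx : 0 < x) :
    IntegrableOn (fun ψ => dx k φ x ψ ^ 2 * (1 + ψ) / vel f ε φ x ψ) (Ioi 0) ∧
      ∫ ψ in Ioi (0 : ℝ), dx k φ x ψ ^ 2 * (1 + ψ) / vel f ε φ x ψ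
        ≤ ((normX f ε σ K φ).toReal * (x + 1) ^ (σ k - k)) ^ 2 := by
  have hx1 : 0 < x + 1 := by linarith
  have hbr : bracket x = x + 1 := by
    rw [bracket, abs_of_pos hx]
    ring
  have hdc : ContinuousOn (dx k φ x) (Ioi 0) := (h.continuousOn_dx hk hx).mono Ioi_subset_Ici_self
  have hvc := h.continuousOn_vel hx
  set G : ℝ → ℝ := fun ψ => dx k φ x ψ * (bracket (√ψ) / √(vel f ε φ x ψ))
      * bracket x ^ ((k : ℝ) - σ k) with hG
  have hGc : ContinuousOn G (Ioi 0) := by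
    have hb : ContinuousOn (fun ψ => bracket (√ψ)) (Ioi 0) := by
      unfold bracket
      fun_prop
    exact (hdc.mul (hb.div hvc.sqrt fun ψ hψ => (Real.sqrt_pos.2 (h.vel_pos hx hψ)).ne')).mul
      continuousOn_const
  have hle : eLpNorm G 2 (volume.restrict (Ioi 0))
      ≤ ENNReal.ofReal (normX f ε σ K φ).toReal := by
    refine le_trans ?_ (h.normXk_le hk)
    rw [normXk]
    refine le_trans ?_ (le_self_add.trans le_self_add)
    refine le_trans ?_ le_add_self
    exact le_iSup₂ (f := fun (x : ℝ) (_ : 0 < x) => normL2 (fun ψ => dx k φ x ψ *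
      (bracket (√ψ) / √(vel f ε φ x ψ)) * bracket x ^ ((k : ℝ) - σ k))) x hx
  obtain ⟨hi, hI⟩ := integral_sq_le_of_eLpNorm_le (hGc.aestronglyMeasurable measurableSet_Ioi)
    ENNReal.toReal_nonneg hle
  have hpt : ∀ ψ ∈ Ioi (0 : ℝ), dx k φ x ψ ^ 2 * (1 + ψ) / vel f ε φ x ψ
      ≤ ((x + 1) ^ (σ k - k)) ^ 2 * G ψ ^ 2 := by
    intro ψ hψ
    have hψ' : (0 : ℝ) < ψ := hψ
    have hu := h.vel_pos hx hψ'
    have hp : (x + 1) ^ (σ k - k) * (x + 1) ^ ((k : ℝ) - σ k) = 1 := by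
      rw [← Real.rpow_add hx1]
      simp
    have hGe : ((x + 1) ^ (σ k - k)) ^ 2 * G ψ ^ 2
        = dx k φ x ψ ^ 2 * (1 + √ψ) ^ 2 / vel f ε φ x ψ := by
      have h1 : G ψ = dx k φ x ψ * ((1 + √ψ) / √(vel f ε φ x ψ)) * (x + 1) ^ ((k : ℝ) - σ k) := by
        rw [hG]
        simp only [hbr]
        rw [bracket, abs_of_nonneg (Real.sqrt_nonneg ψ)]
      calc ((x + 1) ^ (σ k - k)) ^ 2 * G ψ ^ 2
          = (dx k φ x ψ * ((1 + √ψ) / √(vel f ε φ x ψ))) ^ 2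
            * ((x + 1) ^ (σ k - k) * (x + 1) ^ ((k : ℝ) - σ k)) ^ 2 := by
            rw [h1]
            ring
        _ = _ := by
            rw [hp, one_pow, mul_one, mul_pow, div_pow, Real.sq_sqrt hu.le]
            ring
    rw [hGe]
    gcongr
    nlinarith [Real.sq_sqrt hψ'.le, Real.sqrt_nonneg ψ]
  have hint : IntegrableOn (fun ψ => dx k φ x ψ ^ 2 * (1 + ψ) / vel f ε φ x ψ) (Ioi 0) := by
    refine (hi.const_mul (((x + 1) ^ (σ k - k)) ^ 2)).mono' ?_ ?_
    · exact (((hdc.pow 2).mul (by fun_prop : ContinuousOn (fun ψ : ℝ => 1 + ψ) (Ioi 0))).div hvc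
        fun ψ hψ => (h.vel_pos hx hψ).ne').aestronglyMeasurable measurableSet_Ioi
    · filter_upwards [self_mem_ae_restrict measurableSet_Ioi] with ψ hψ
      have hψ' : (0 : ℝ) < ψ := hψ
      have hu := h.vel_pos hx hψ'
      rw [Real.norm_of_nonneg (by positivity)]
      exact hpt ψ hψ
  refine ⟨hint, (setIntegral_mono_on hint (hi.const_mul _) measurableSet_Ioi hpt).trans ?_⟩
  rw [integral_const_mul, mul_comm, mul_pow]
  gcongr

theorem integral_sq_le (h : IsSmallSolution f ε K σ M φ) {x : ℝ} (hx : 0 < x) :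
    IntegrableOn (fun ψ => φ x ψ ^ 2) (Ioi 0) ∧
      ∫ ψ in Ioi (0 : ℝ), φ x ψ ^ 2 ≤ (normX f ε σ K φ).toReal ^ 2 := by
  refine integral_sq_le_of_eLpNorm_le
    ((h.contDiffOn_slice hx).continuousOn.aestronglyMeasurable measurableSet_Ioi)
    ENNReal.toReal_nonneg ?_
  refine le_trans ?_ (h.normXk_le (Nat.zero_le K))
  rw [normXk]
  refine le_trans ?_ (le_self_add.trans (le_self_add.trans le_self_add))
  refine le_trans (le_of_eq ?_) (le_iSup₂ (f := fun (x : ℝ) (_ : 0 < x) => normL2 (fun ψ =>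
    dx 0 φ x ψ * bracket x ^ (((0 : ℕ) : ℝ) - σ 0))) x hx)
  simp [normL2, dx_zero, h.sigma_zero]

theorem coeffA_eq (h : IsSmallSolution f ε K σ M φ) (x ψ : ℝ) : coeffA f ε φ x ψ
    = 2 * -ubarYY f x ψ / (ubar f x ψ * (ubar f x ψ + vel f ε φ x ψ)) := by
  rw [coeffA, ← h.ubar_add_eps_rho x ψ]
  ring

theorem ubarYY_bounds (h : IsSmallSolution f ε K σ M φ) {x ψ : ℝ} (hx : 0 < x) (hψ : 0 < ψ) :
    0 ≤ -ubarYY f x ψ ∧ -ubarYY f x ψ ≤ sqProfile f (ψ / √(x + 1)) / (x + 1) := by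
  have hr : 0 < √(x + 1) := Real.sqrt_pos.2 (by linarith)
  have hs : 0 < ψ / √(x + 1) := by positivity
  have h1 := h.blasius.two_mul_shearProfile_le hs
  have h2 := mul_pos hs (h.blasius.shearProfile_pos hs)
  rw [h.blasius.ubarYY_eq hx hψ, neg_neg]
  refine ⟨by positivity, ?_⟩
  gcongr
  linarith

theorem coeffA_bounds (h : IsSmallSolution f ε K σ M φ) {x ψ : ℝ} (hx : 0 < x) (hψ : 0 < ψ) :
    0 ≤ coeffA f ε φ x ψ ∧ coeffA f ε φ x ψ ≤ 2 / (x + 1) := by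
  obtain ⟨h1, h2⟩ := h.ubarYY_bounds hx hψ
  have hb := h.blasius.ubar_pos hx hψ
  have hu := h.vel_pos hx hψ
  rw [← h.blasius.ubar_sq hx hψ] at h2
  rw [h.coeffA_eq]
  refine ⟨by positivity, ?_⟩
  rw [div_le_iff₀ (by positivity)]
  have h3 : 2 / (x + 1) * (ubar f x ψ * (ubar f x ψ + vel f ε φ x ψ))
      = 2 * (ubar f x ψ ^ 2 / (x + 1)) + 2 / (x + 1) * (ubar f x ψ * vel f ε φ x ψ) := by ring
  have h4 : 0 ≤ 2 / (x + 1) * (ubar f x ψ * vel f ε φ x ψ) := by positivity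
  rw [h3]
  linarith

theorem rpow_quarter_sq {X : ℝ} (hX : 0 ≤ X) : (X ^ (1 / 4 : ℝ)) ^ 2 = √X := by
  rw [← Real.rpow_natCast, ← Real.rpow_mul hX, Real.sqrt_eq_rpow]
  norm_num

theorem rpow_quarter_pow_four {X : ℝ} (hX : 0 ≤ X) : (X ^ (1 / 4 : ℝ)) ^ 4 = X := by
  rw [← Real.rpow_natCast, ← Real.rpow_mul hX]
  norm_num

theorem slice (h : IsSmallSolution f ε K σ M φ) {x : ℝ} (hx : 0 < x) :
    Slice f ε ((x + 1) ^ (1 / 4 : ℝ)) ((x + 1) ^ σ 1) (normX f ε σ K φ).toReal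
      (φ x) (dpsi φ x) (dpsi (dpsi φ) x) (dx 1 φ x) (coeffA f ε φ x) := by
  have hx1 : 0 < x + 1 := by linarith
  have h2 : ((x + 1) ^ (1 / 4 : ℝ)) ^ 2 = √(x + 1) := rpow_quarter_sq hx1.le
  have h4 : ((x + 1) ^ (1 / 4 : ℝ)) ^ 4 = x + 1 := rpow_quarter_pow_four hx1.le
  have hone : 1 ≤ K := one_le_two.trans h.two_le
  have hsl := h.contDiffOn_slice hx
  have hd0 : ∀ ψ, 0 < ψ → HasDerivAt (φ x) (dpsi φ x ψ) ψ := fun ψ hψ => by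
    have := hasDerivAt_iteratedDeriv_of_contDiffOn hsl 0 hψ
    rw [zero_add, iteratedDeriv_one] at this
    exact this.congr_of_eventuallyEq (Eventually.of_forall fun _ => by simp)
  have hd1 : ∀ ψ, 0 < ψ → HasDerivAt (dpsi φ x) (dpsi (dpsi φ) x ψ) ψ := fun ψ hψ => by
    have h1 := hasDerivAt_iteratedDeriv_of_contDiffOn hsl 1 hψ
    rw [iteratedDeriv_one] at h1
    exact h1.differentiableAt.hasDerivAt
  have hiter : iteratedDeriv 2 (φ x) = dpsi (dpsi φ) x := by
    rw [iteratedDeriv_succ, iteratedDeriv_one]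
    rfl
  have hw := h.integral_dx_sq_le (Nat.zero_le K) hx
  have hk := h.integral_dx_sq_le hone hx
  simp only [dx_zero, h.sigma_zero, Nat.cast_zero, sub_zero, Real.rpow_zero, mul_one] at hw
  have hvel : ∀ (m : ℝ → ℝ), ∀ ψ ∈ Ioi (0 : ℝ), m ψ / vel f ε φ x ψ
      = m ψ / √(sqProfile f (ψ / ((x + 1) ^ (1 / 4 : ℝ)) ^ 2) + ε * φ x ψ) := fun m ψ hψ => by
    rw [h.vel_eq hx hψ, h2]
  have hkq : (normX f ε σ K φ).toReal * (x + 1) ^ (σ 1 - (1 : ℕ))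
      = (normX f ε σ K φ).toReal * (x + 1) ^ σ 1 / ((x + 1) ^ (1 / 4 : ℝ)) ^ 4 := by
    rw [h4, Nat.cast_one, Real.rpow_sub_one hx1.ne', mul_div_assoc]
  refine
    { eps_pos := h.eps_pos
      one_le_t := Real.one_le_rpow (by linarith) (by norm_num)
      one_le_q := Real.one_le_rpow (by linarith) h.sigma_one_pos.le
      q_le_t := Real.rpow_le_rpow_of_exponent_le (by linarith) (by linarith [h.sigma_one_le])
      N_nonneg := ENNReal.toReal_nonneg
      hasDeriv := hd0
      hasDeriv₁ := hd1
      cont₂ := ?_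
      wall := ?_
      wall₁ := ?_
      far := h.sol.far x hx
      pos := ?_
      coeff_nonneg := fun ψ hψ => (h.coeffA_bounds hx hψ).1
      coeff_le := fun ψ hψ => by
        rw [h4]
        exact (h.coeffA_bounds hx hψ).2
      eqn := ?_
      int := (h.integral_sq_le hx).1
      int_le := (h.integral_sq_le hx).2
      intw := hw.1.congr_fun (hvel fun ψ => φ x ψ ^ 2 * (1 + ψ)) measurableSet_Ioi
      intw_le := ?_
      intk := hk.1.congr_fun (hvel fun ψ => dx 1 φ x ψ ^ 2 * (1 + ψ)) measurableSet_Ioi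
      intk_le := ?_ }
  · rw [← hiter]
    exact fun ψ hψ =>
      (hasDerivAt_iteratedDeriv_of_contDiffOn hsl 2 hψ).continuousAt.continuousWithinAt
  · have h1 := (h.continuousOn_dx (Nat.zero_le K) hx) 0 (mem_Ici.2 le_rfl)
    rw [dx_zero, ContinuousWithinAt, h.sol.wall x hx] at h1
    exact h1.mono_left (nhdsWithin_mono _ Ioi_subset_Ici_self)
  · obtain ⟨G, hG, he⟩ := h.sol.continuous_dpsi 0 (Nat.zero_le K)
    refine ⟨G (x, 0), ?_⟩
    have h1 : ContinuousWithinAt (fun ψ : ℝ => G (x, ψ)) (Ici 0) 0 :=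
      (hG.comp (f := fun ψ : ℝ => (x, ψ)) (by fun_prop) fun _ hψ => ⟨hx, hψ⟩) 0 (mem_Ici.2 le_rfl)
    refine (h1.mono_left (nhdsWithin_mono _ Ioi_subset_Ici_self)).congr' ?_
    filter_upwards [self_mem_nhdsWithin] with ψ hψ
    rw [he (x, ψ) hx hψ, dx_zero]
  · intro ψ hψ
    rw [h2]
    exact h.sq_vel_pos hx hψ
  · intro ψ hψ
    have h1 := h.sol.eqn x ψ hx hψ
    rw [h.ubar_add_eps_rho] at h1
    rw [h2, ← h.vel_eq hx hψ]
    linarith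
  · rw [← setIntegral_congr_fun measurableSet_Ioi (hvel fun ψ => φ x ψ ^ 2 * (1 + ψ))]
    exact hw.2
  · rw [← setIntegral_congr_fun measurableSet_Ioi (hvel fun ψ => dx 1 φ x ψ ^ 2 * (1 + ψ)), ← hkq]
    exact hk.2

theorem abs_le_mul_ubar_sq (h : IsSmallSolution f ε K σ M φ) {x ψ : ℝ} (hx : 0 < x)
    (hψ : 0 < ψ) : |φ x ψ| ≤ ratioConst (2 * shearProfile f 1) * (normX f ε σ K φ).toReal
      * ((x + 1) ^ σ 1 / (x + 1) ^ (1 / 4 : ℝ)) * sqProfile f (ψ / √(x + 1)) := by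
  have := (h.slice hx).abs_le_mul_sqProfile h.blasius rfl h.norm_toReal_le h.small₁ h.small₂ hψ
  rwa [rpow_quarter_sq (by linarith)] at this

theorem ratioConst_nonneg (h : IsSmallSolution f ε K σ M φ) :
    0 ≤ ratioConst (2 * shearProfile f 1) := by
  have h1 := h.blasius.shearProfile_pos one_pos
  have h2 := wallConst_pos (2 * shearProfile f 1)
  rw [ratioConst]
  positivity

theorem eps_mul_abs_le (h : IsSmallSolution f ε K σ M φ) {x ψ : ℝ} (hx : 0 < x) (hψ : 0 < ψ) :
    ε * |φ x ψ| ≤ 3 / 4 * sqProfile f (ψ / √(x + 1)) := by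
  have hr : 0 < √(x + 1) := Real.sqrt_pos.2 (by linarith)
  have hB := h.blasius.sqProfile_pos (show 0 < ψ / √(x + 1) by positivity)
  have hR := h.ratioConst_nonneg
  have hs := h.slice hx
  have hε := h.eps_pos
  have hqt : (x + 1) ^ σ 1 / (x + 1) ^ (1 / 4 : ℝ) ≤ 1 := (div_le_one hs.t_pos).2 hs.q_le_t
  calc ε * |φ x ψ| ≤ ε * (ratioConst (2 * shearProfile f 1) * (normX f ε σ K φ).toReal
      * ((x + 1) ^ σ 1 / (x + 1) ^ (1 / 4 : ℝ)) * sqProfile f (ψ / √(x + 1))) := by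
        gcongr
        exact h.abs_le_mul_ubar_sq hx hψ
    _ ≤ ε * (ratioConst (2 * shearProfile f 1) * M * 1 * sqProfile f (ψ / √(x + 1))) := by
        have := h.norm_toReal_le
        have := h.M_pos
        gcongr
    _ = ε * (ratioConst (2 * shearProfile f 1) * M) * sqProfile f (ψ / √(x + 1)) := by ring
    _ ≤ _ := by
        gcongr
        exact h.small₃

/-- The velocity is comparable to the Blasius velocity. -/
theorem vel_sq_bounds (h : IsSmallSolution f ε K σ M φ) {x ψ : ℝ} (hx : 0 < x) (hψ : 0 < ψ) :
    sqProfile f (ψ / √(x + 1)) ≤ 4 * vel f ε φ x ψ ^ 2 ∧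
      vel f ε φ x ψ ^ 2 ≤ 2 * sqProfile f (ψ / √(x + 1)) := by
  have hr : 0 < √(x + 1) := Real.sqrt_pos.2 (by linarith)
  have hB := h.blasius.sqProfile_pos (show 0 < ψ / √(x + 1) by positivity)
  have h1 := h.eps_mul_abs_le hx hψ
  rw [h.vel_sq hx hψ]
  have h2 := mul_le_mul_of_nonneg_left (neg_abs_le (φ x ψ)) h.eps_pos.le
  have h3 := mul_le_mul_of_nonneg_left (le_abs_self (φ x ψ)) h.eps_pos.le
  constructor <;> linarith

end IsSmallSolution

/-! ### Differentiation of the energy under the integral sign -/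

theorem sq_le_sq_add_integral {c c' : ℝ → ℝ} {α β x y : ℝ}
    (hc : ∀ z ∈ Icc α β, HasDerivAt c (c' z) z) (hc' : ContinuousOn c' (Icc α β))
    (hx : x ∈ Icc α β) (hy : y ∈ Icc α β) :
    c x ^ 2 ≤ c y ^ 2 + ∫ z in Icc α β, (c z ^ 2 + c' z ^ 2) := by
  have hcc : ContinuousOn c (Icc α β) := fun z hz => (hc z hz).continuousAt.continuousWithinAt
  have hsub : uIcc y x ⊆ Icc α β := uIcc_subset_Icc hy hx
  have h1 := intervalIntegral.integral_eq_sub_of_hasDerivAt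
    (f := fun z => c z ^ 2) (f' := fun z => 2 * (c z * c' z))
    (fun z hz => ((hc z (hsub hz)).pow 2).congr_deriv (by simp; ring))
    (((continuousOn_const.mul (hcc.mul hc')).mono hsub).intervalIntegrable)
  have hi : IntegrableOn (fun z => c z ^ 2 + c' z ^ 2) (Icc α β) :=
    ((hcc.pow 2).add (hc'.pow 2)).integrableOn_Icc
  have h2 : ‖∫ z in y..x, 2 * (c z * c' z)‖ ≤ ∫ z in uIoc y x, (c z ^ 2 + c' z ^ 2) := by
    refine (intervalIntegral.norm_integral_le_integral_norm_uIoc).trans ?_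
    refine setIntegral_mono_on ?_ (hi.mono_set (uIoc_subset_uIcc.trans hsub))
      measurableSet_uIoc fun z _ => ?_
    · have h3 : IntegrableOn (fun z => 2 * (c z * c' z)) (uIcc y x) :=
        ((continuousOn_const.mul (hcc.mul hc')).mono hsub).integrableOn_uIcc
      exact (h3.mono_set uIoc_subset_uIcc).norm
    · rw [Real.norm_eq_abs, abs_le]
      constructor <;> nlinarith [sq_nonneg (c z - c' z), sq_nonneg (c z + c' z)]
  have h3 : ∫ z in uIoc y x, (c z ^ 2 + c' z ^ 2) ≤ ∫ z in Icc α β, (c z ^ 2 + c' z ^ 2) :=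
    setIntegral_mono_set hi (Eventually.of_forall fun z => by positivity)
      (uIoc_subset_uIcc.trans hsub).eventuallyLE
  have h4 := le_abs_self (∫ z in y..x, 2 * (c z * c' z))
  rw [Real.norm_eq_abs] at h2
  linarith

/-- Tonelli's theorem for a nonnegative continuous function whose slices have uniformly bounded
integrals. -/
theorem integrableOn_integral_of_le {Φ : ℝ → ℝ → ℝ} {α β Λ : ℝ}
    (hΦ : ContinuousOn (fun p : ℝ × ℝ => Φ p.1 p.2) (Icc α β ×ˢ Ioi 0))
    (h0 : ∀ x ∈ Icc α β, ∀ ψ, 0 < ψ → 0 ≤ Φ x ψ)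
    (hi : ∀ x ∈ Icc α β, IntegrableOn (Φ x) (Ioi 0))
    (hle : ∀ x ∈ Icc α β, ∫ ψ in Ioi (0 : ℝ), Φ x ψ ≤ Λ) :
    IntegrableOn (fun ψ => ∫ x in Icc α β, Φ x ψ) (Ioi 0) := by
  have hm : AEStronglyMeasurable (fun p : ℝ × ℝ => Φ p.1 p.2)
      ((volume.restrict (Icc α β)).prod (volume.restrict (Ioi 0))) := by
    rw [Measure.prod_restrict]
    exact hΦ.aestronglyMeasurable (measurableSet_Icc.prod measurableSet_Ioi)
  have hp : Integrable (fun p : ℝ × ℝ => Φ p.1 p.2)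
      ((volume.restrict (Icc α β)).prod (volume.restrict (Ioi 0))) := by
    rw [integrable_prod_iff hm]
    constructor
    · filter_upwards [self_mem_ae_restrict measurableSet_Icc] with x hx
      exact hi x hx
    · refine Integrable.mono' (integrable_const Λ) hm.norm.integral_prod_right' ?_
      filter_upwards [self_mem_ae_restrict measurableSet_Icc] with x hx
      rw [Real.norm_of_nonneg (integral_nonneg fun _ => norm_nonneg _)]
      refine le_trans (le_of_eq ?_) (hle x hx)
      exact setIntegral_congr_fun measurableSet_Ioi fun ψ hψ =>
        Real.norm_of_nonneg (h0 x hx ψ hψ)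
  exact hp.integral_prod_right

/-- The `x`-derivative of the density `φ² ⟨ψ⟩ / u`. -/
noncomputable def divDensityDx (f : ℝ → ℝ) (ε : ℝ) (φ : ℝ → ℝ → ℝ) (x ψ : ℝ) : ℝ :=
  (2 * (φ x ψ * dx 1 φ x ψ) / vel f ε φ x ψ
    - φ x ψ ^ 2 * (ubarYY f x ψ + ε * dx 1 φ x ψ) / (2 * vel f ε φ x ψ ^ 3)) * (1 + ψ)

namespace IsSmallSolution

variable {f : ℝ → ℝ} {ε : ℝ} {K : ℕ} {σ : ℕ → ℝ} {M : ℝ} {φ : ℝ → ℝ → ℝ}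

theorem divDensity_eq (f : ℝ → ℝ) (ε : ℝ) (φ : ℝ → ℝ → ℝ) (x : ℝ) {ψ : ℝ} (hψ : 0 < ψ) :
    divDensity f ε φ x ψ = φ x ψ ^ 2 * (1 + ψ) / vel f ε φ x ψ := by
  rw [divDensity, bracket, abs_of_pos hψ]
  ring

theorem hasDerivAt_divDensity (h : IsSmallSolution f ε K σ M φ) {x ψ : ℝ} (hx : 0 < x)
    (hψ : 0 < ψ) :
    HasDerivAt (fun x => divDensity f ε φ x ψ) (divDensityDx f ε φ x ψ) x := by
  have hu := h.vel_pos hx hψ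
  have h0 : HasDerivAt (fun x => φ x ψ) (dx 1 φ x ψ) x := by
    have := h.hasDerivAt_dx 0 hx hψ
    rwa [dx_zero] at this
  have h1 := (h.blasius.hasDerivAt_ubar_sq hx hψ).add (h0.const_mul ε)
  have h2 : HasDerivAt (fun x => vel f ε φ x ψ)
      ((ubarYY f x ψ + ε * dx 1 φ x ψ) / (2 * vel f ε φ x ψ)) x := by
    have h3 := h1.sqrt (h.sq_vel_pos hx hψ).ne'
    rw [h.vel_eq hx hψ]
    refine h3.congr_of_eventuallyEq ?_
    filter_upwards [Ioi_mem_nhds hx] with z hz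
    exact h.vel_eq hz hψ
  have h3 := (((h0.pow 2).mul_const (1 + ψ)).div h2 hu.ne')
  refine (h3.congr_deriv ?_).congr_of_eventuallyEq
    (Eventually.of_forall fun z => divDensity_eq f ε φ z hψ)
  rw [divDensityDx]
  simp only [Nat.cast_ofNat, Nat.add_one_sub_one, pow_one, Pi.pow_apply]
  field_simp

theorem abs_divDensityDx_le (h : IsSmallSolution f ε K σ M φ) {x ψ : ℝ} (hx : 0 < x)
    (hψ : 0 < ψ) : |divDensityDx f ε φ x ψ|
      ≤ 4 * ((φ x ψ ^ 2 + dx 1 φ x ψ ^ 2) * ((1 + ψ) / vel f ε φ x ψ)) := by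
  have hr : 0 < √(x + 1) := Real.sqrt_pos.2 (by linarith)
  have hB := h.blasius.sqProfile_pos (show 0 < ψ / √(x + 1) by positivity)
  have hu := h.vel_pos hx hψ
  obtain ⟨hb1, hb2⟩ := h.vel_sq_bounds hx hψ
  obtain ⟨hy1, hy2⟩ := h.ubarYY_bounds hx hψ
  have hφ := h.eps_mul_abs_le hx hψ
  have hε := h.eps_pos
  have hy3 : -ubarYY f x ψ ≤ 4 * vel f ε φ x ψ ^ 2 :=
    hy2.trans ((div_le_self hB.le (by linarith)).trans hb1)
  rw [divDensityDx]
  set u := vel f ε φ x ψ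
  set p := φ x ψ
  set k := dx 1 φ x ψ
  set Y := ubarYY f x ψ
  have e : (2 * (p * k) / u - p ^ 2 * (Y + ε * k) / (2 * u ^ 3)) * (1 + ψ)
      = (2 * (p * k) - p ^ 2 * (Y + ε * k) / (2 * u ^ 2)) * ((1 + ψ) / u) := by
    field_simp
  have hwt : 0 ≤ (1 + ψ) / u := by positivity
  rw [e, abs_mul, abs_of_nonneg hwt, ← mul_assoc (4 : ℝ)]
  refine mul_le_mul_of_nonneg_right ?_ hwt
  have hpk : |p| * |k| ≤ (p ^ 2 + k ^ 2) / 2 := by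
    nlinarith [sq_nonneg (|p| - |k|), sq_abs p, sq_abs k]
  have h1 : |p ^ 2 * (Y + ε * k) / (2 * u ^ 2)| ≤ 2 * p ^ 2 + 3 / 2 * (|p| * |k|) := by
    rw [abs_div, abs_of_pos (show 0 < 2 * u ^ 2 by positivity), div_le_iff₀ (by positivity),
      abs_mul, abs_of_nonneg (sq_nonneg p)]
    have h2 : |Y + ε * k| ≤ 4 * u ^ 2 + ε * |k| := by
      refine (abs_add_le _ _).trans (add_le_add ?_ ?_)
      · rw [abs_of_nonpos (by linarith)]
        exact hy3
      · rw [abs_mul, abs_of_pos hε]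
    have h3 : p ^ 2 * (ε * |k|) ≤ 3 * u ^ 2 * (|p| * |k|) := by
      have h4 : ε * |p| ≤ 3 * u ^ 2 := by linarith
      calc p ^ 2 * (ε * |k|) = ε * |p| * (|p| * |k|) := by
            rw [← sq_abs p]
            ring
        _ ≤ _ := by gcongr
    calc p ^ 2 * |Y + ε * k| ≤ p ^ 2 * (4 * u ^ 2 + ε * |k|) := by gcongr
      _ ≤ (2 * p ^ 2 + 3 / 2 * (|p| * |k|)) * (2 * u ^ 2) := by linarith
  have h5 : |2 * (p * k)| = 2 * (|p| * |k|) := by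
    rw [abs_mul, abs_mul, abs_two]
  calc |2 * (p * k) - p ^ 2 * (Y + ε * k) / (2 * u ^ 2)|
      ≤ |2 * (p * k)| + |p ^ 2 * (Y + ε * k) / (2 * u ^ 2)| := abs_sub _ _
    _ ≤ 4 * (p ^ 2 + k ^ 2) := by nlinarith [sq_nonneg p, sq_nonneg k]

theorem integrableOn_divDensity (h : IsSmallSolution f ε K σ M φ) {x : ℝ} (hx : 0 < x) :
    IntegrableOn (divDensity f ε φ x) (Ioi 0) := by
  have h1 := (h.integral_dx_sq_le (Nat.zero_le K) hx).1
  rw [dx_zero] at h1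
  exact h1.congr_fun (fun ψ hψ => (divDensity_eq f ε φ x hψ).symm) measurableSet_Ioi

theorem sigma_le (h : IsSmallSolution f ε K σ M φ) {k : ℕ} (hk : k ≤ 2) : σ k ≤ k := by
  have h0 := h.sigma_zero
  have h1 := h.sigma_one_le
  have h2 := h.sigma_two_le
  interval_cases k
  · simp [h0]
  · rw [Nat.cast_one]
    linarith
  · rw [Nat.cast_ofNat]
    linarith

/-- For times in a compact interval the weight `⟨ψ⟩ / u` may be replaced by one that does not depend
on the time. -/
theorem fixed_weight_bounds (h : IsSmallSolution f ε K σ M φ) {x R ψ : ℝ} (hx : 0 < x)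
    (hxR : x + 1 ≤ R) (hψ : 0 < ψ) :
    (1 + ψ) / vel f ε φ x ψ ≤ 2 * ((1 + ψ) / √(sqProfile f (ψ / √R))) ∧
      (1 + ψ) / √(sqProfile f (ψ / √R)) ≤ √(2 * √R) * ((1 + ψ) / vel f ε φ x ψ) := by
  have hr : 0 < √(x + 1) := Real.sqrt_pos.2 (by linarith)
  have hr1 : 1 ≤ √(x + 1) := Real.one_le_sqrt.2 (by linarith)
  have hrR : √(x + 1) ≤ √R := Real.sqrt_le_sqrt hxR
  have hR : 0 < √R := hr.trans_le hrR
  have hs : ψ / √R ≤ ψ / √(x + 1) := by gcongr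
  have hsR : 0 < ψ / √R := by positivity
  have hsx : 0 < ψ / √(x + 1) := by positivity
  have hu := h.vel_pos hx hψ
  have hBR := h.blasius.sqProfile_pos hsR
  have hBR' := Real.sqrt_pos.2 hBR
  obtain ⟨hb1, hb2⟩ := h.vel_sq_bounds hx hψ
  have hmono := h.blasius.monotoneOn_sqProfile (mem_Ioi.2 hsR) (mem_Ioi.2 hsx) hs
  have hanti := h.blasius.antitoneOn_sqProfile_div (mem_Ioi.2 hsR) (mem_Ioi.2 hsx) hs
  have hcomp : sqProfile f (ψ / √(x + 1)) ≤ √R * sqProfile f (ψ / √R) := by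
    simp only at hanti
    rw [div_le_iff₀ hsx] at hanti
    calc sqProfile f (ψ / √(x + 1)) ≤ sqProfile f (ψ / √R) / (ψ / √R) * (ψ / √(x + 1)) := hanti
      _ = √R * sqProfile f (ψ / √R) / √(x + 1) := by field_simp
      _ ≤ √R * sqProfile f (ψ / √R) := div_le_self (by positivity) hr1
  have h1 : √(sqProfile f (ψ / √R)) ≤ 2 * vel f ε φ x ψ := by
    rw [Real.sqrt_le_left (by positivity)]
    nlinarith
  have h2 : vel f ε φ x ψ ≤ √(2 * √R) * √(sqProfile f (ψ / √R)) := by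
    rw [← Real.sqrt_mul (by positivity)]
    refine Real.le_sqrt_of_sq_le ?_
    nlinarith
  constructor
  · rw [mul_div_assoc', div_le_div_iff₀ hu hBR']
    nlinarith
  · rw [mul_div_assoc', div_le_div_iff₀ hBR' hu]
    nlinarith

theorem hasDerivAt_divEnergy (h : IsSmallSolution f ε K σ M φ) {x₀ : ℝ} (hx₀ : 0 < x₀) :
    IntegrableOn (divDensityDx f ε φ x₀) (Ioi 0) ∧
      HasDerivAt (divEnergy f ε φ) (∫ ψ in Ioi (0 : ℝ), divDensityDx f ε φ x₀ ψ) x₀ := by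
  set R := 2 * x₀ + 1 with hR
  set N := (normX f ε σ K φ).toReal
  set J := Icc (x₀ / 2) (2 * x₀) with hJ
  have hJ0 : ∀ x ∈ J, 0 < x := fun x hx => (half_pos hx₀).trans_le hx.1
  have hJR : ∀ x ∈ J, x + 1 ≤ R := fun x hx => by
    have := hx.2
    linarith
  have hx₀J : x₀ ∈ J := ⟨by linarith, by linarith⟩
  have hRpos : 0 < √R := Real.sqrt_pos.2 (by positivity)
  set μ : ℝ → ℝ := fun ψ => (1 + ψ) / √(sqProfile f (ψ / √R)) with hμ
  have hBR : ∀ ψ, 0 < ψ → 0 < √(sqProfile f (ψ / √R)) := fun ψ hψ =>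
    Real.sqrt_pos.2 (h.blasius.sqProfile_pos (div_pos hψ hRpos))
  have hμ0 : ∀ ψ, 0 < ψ → 0 ≤ μ ψ := fun ψ hψ => by
    have := hBR ψ hψ
    positivity
  have hμc : ContinuousOn μ (Ioi 0) := by
    refine ContinuousOn.div (by fun_prop) (ContinuousOn.sqrt fun ψ hψ => ?_)
      fun ψ hψ => (hBR ψ hψ).ne'
    exact (ContinuousAt.comp (f := fun ψ => ψ / √R) (g := sqProfile f)
      (h.blasius.hasDerivAt_sqProfile (div_pos hψ hRpos)).continuousAt
      (by fun_prop)).continuousWithinAt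
  -- the fixed-weight norms of `∂ₓᵏ φ`, `k ≤ 2`, are bounded uniformly over the interval of times
  have hk : ∀ k ≤ 2, ∀ x ∈ J, IntegrableOn (fun ψ => dx k φ x ψ ^ 2 * μ ψ) (Ioi 0) ∧
      ∫ ψ in Ioi (0 : ℝ), dx k φ x ψ ^ 2 * μ ψ ≤ √(2 * √R) * N ^ 2 := by
    intro k hk x hx
    have hx0 := hJ0 x hx
    have hkK := hk.trans h.two_le
    obtain ⟨hi, hle⟩ := h.integral_dx_sq_le hkK hx0
    have hpt : ∀ ψ ∈ Ioi (0 : ℝ), dx k φ x ψ ^ 2 * μ ψ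
        ≤ √(2 * √R) * (dx k φ x ψ ^ 2 * (1 + ψ) / vel f ε φ x ψ) := fun ψ hψ => by
      have h1 := (h.fixed_weight_bounds hx0 (hJR x hx) hψ).2
      calc dx k φ x ψ ^ 2 * μ ψ
          ≤ dx k φ x ψ ^ 2 * (√(2 * √R) * ((1 + ψ) / vel f ε φ x ψ)) := by gcongr
        _ = _ := by ring
    have hint : IntegrableOn (fun ψ => dx k φ x ψ ^ 2 * μ ψ) (Ioi 0) := by
      refine (hi.const_mul (√(2 * √R))).mono' (((((h.continuousOn_dx hkK hx0).mono
        Ioi_subset_Ici_self).pow 2).mul hμc).aestronglyMeasurable measurableSet_Ioi) ?_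
      filter_upwards [self_mem_ae_restrict measurableSet_Ioi] with ψ hψ
      rw [Real.norm_of_nonneg (mul_nonneg (sq_nonneg _) (hμ0 ψ hψ))]
      exact hpt ψ hψ
    refine ⟨hint, (setIntegral_mono_on hint (hi.const_mul _) measurableSet_Ioi hpt).trans ?_⟩
    rw [integral_const_mul]
    have h1 : (x + 1) ^ (σ k - k) ≤ 1 :=
      Real.rpow_le_one_of_one_le_of_nonpos (by linarith) (by linarith [h.sigma_le hk])
    have h2 : 0 ≤ (x + 1) ^ (σ k - k) := Real.rpow_nonneg (by linarith) _
    have hN : 0 ≤ N := ENNReal.toReal_nonneg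
    have h3 : (N * (x + 1) ^ (σ k - k)) ^ 2 ≤ N ^ 2 := by
      gcongr
      exact mul_le_of_le_one_right hN h1
    gcongr
    exact hle.trans h3
  set Φ : ℝ → ℝ → ℝ := fun x ψ =>
    dx 0 φ x ψ ^ 2 * μ ψ + 2 * (dx 1 φ x ψ ^ 2 * μ ψ) + dx 2 φ x ψ ^ 2 * μ ψ with hΦ
  have hΦint : IntegrableOn (fun ψ => ∫ x in J, Φ x ψ) (Ioi 0) := by
    refine integrableOn_integral_of_le (Λ := 4 * (√(2 * √R) * N ^ 2)) ?_ ?_ ?_ ?_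
    · have hc : ∀ k ≤ 2, ContinuousOn (fun p : ℝ × ℝ => dx k φ p.1 p.2 ^ 2 * μ p.2)
          (J ×ˢ Ioi 0) := fun k hk =>
        (((h.sol.continuous_dx k (hk.trans h.two_le)).mono
          fun p hp => ⟨hJ0 p.1 hp.1, le_of_lt hp.2⟩).pow 2).mul
          (hμc.comp continuousOn_snd fun p hp => hp.2)
      exact ((hc 0 (by norm_num)).add (continuousOn_const.mul (hc 1 (by norm_num)))).add
        (hc 2 le_rfl)
    · intro x _ ψ hψ
      have := hμ0 ψ hψ
      positivity
    · intro x hx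
      exact ((hk 0 (by norm_num) x hx).1.add ((hk 1 (by norm_num) x hx).1.const_mul 2)).add
        (hk 2 le_rfl x hx).1
    · intro x hx
      obtain ⟨i0, l0⟩ := hk 0 (by norm_num) x hx
      obtain ⟨i1, l1⟩ := hk 1 (by norm_num) x hx
      obtain ⟨i2, l2⟩ := hk 2 le_rfl x hx
      have e : ∫ ψ in Ioi (0 : ℝ), Φ x ψ = (∫ ψ in Ioi (0 : ℝ), dx 0 φ x ψ ^ 2 * μ ψ)
          + 2 * (∫ ψ in Ioi (0 : ℝ), dx 1 φ x ψ ^ 2 * μ ψ)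
          + ∫ ψ in Ioi (0 : ℝ), dx 2 φ x ψ ^ 2 * μ ψ := by
        rw [← integral_const_mul, ← integral_add i0 (i1.const_mul 2)]
        exact integral_add (i0.add (i1.const_mul 2)) i2
      linarith
  have hmeas : ∀ x, 0 < x → ContinuousOn (divDensityDx f ε φ x) (Ioi 0) := by
    intro x hx
    have hv := h.continuousOn_vel hx
    have hv0 : ∀ ψ ∈ Ioi (0 : ℝ), vel f ε φ x ψ ≠ 0 := fun ψ hψ => (h.vel_pos hx hψ).ne'
    have hp : ContinuousOn (φ x) (Ioi 0) := (h.contDiffOn_slice hx).continuousOn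
    have hk : ContinuousOn (dx 1 φ x) (Ioi 0) :=
      (h.continuousOn_dx (one_le_two.trans h.two_le) hx).mono Ioi_subset_Ici_self
    have hY : ContinuousOn (ubarYY f x) (Ioi 0) := by
      have hr : 0 < √(x + 1) := Real.sqrt_pos.2 (by linarith)
      have h1 : ContinuousOn (fun ψ => shearProfile f (ψ / √(x + 1))) (Ioi 0) :=
        h.blasius.continuousOn_shearProfile.comp (by fun_prop)
          fun ψ hψ => mem_Ioi.2 (div_pos hψ hr)
      refine ContinuousOn.congr ?_ fun ψ hψ => h.blasius.ubarYY_eq hx hψ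
      exact (((continuousOn_id.div_const _).mul h1).div_const _).neg
    refine ContinuousOn.mul (ContinuousOn.sub ?_ ?_) (by fun_prop)
    · exact (continuousOn_const.mul (hp.mul hk)).div hv hv0
    · exact ((hp.pow 2).mul (hY.add (continuousOn_const.mul hk))).div
        (continuousOn_const.mul (hv.pow 3)) fun ψ hψ =>
          mul_ne_zero two_ne_zero (pow_ne_zero _ (hv0 ψ hψ))
  refine hasDerivAt_integral_of_dominated_loc_of_deriv_le
    (bound := fun ψ => 8 * (dx 0 φ x₀ ψ ^ 2 * μ ψ + dx 1 φ x₀ ψ ^ 2 * μ ψ + ∫ x in J, Φ x ψ))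
    (s := J) (Icc_mem_nhds (by linarith) (by linarith)) ?_ (h.integrableOn_divDensity hx₀)
    ((hmeas x₀ hx₀).aestronglyMeasurable measurableSet_Ioi) ?_ ?_ ?_
  · filter_upwards [Ioi_mem_nhds hx₀] with x hx
    exact (h.integrableOn_divDensity hx).aestronglyMeasurable
  · filter_upwards [self_mem_ae_restrict measurableSet_Ioi] with ψ hψ x hx
    have hψ' : (0 : ℝ) < ψ := hψ
    have hd : ∀ k, ∀ z ∈ J, HasDerivAt (fun x => dx k φ x ψ) (dx (k + 1) φ z ψ) z :=
      fun k z hz => h.hasDerivAt_dx k (hJ0 z hz) hψ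
    have hdc : ∀ k, ContinuousOn (fun x => dx k φ x ψ) J := fun k z hz =>
      (hd k z hz).continuousAt.continuousWithinAt
    have s0 := sq_le_sq_add_integral (hd 0) (hdc 1) hx hx₀J
    have s1 := sq_le_sq_add_integral (hd 1) (hdc 2) hx hx₀J
    have e : ∫ x in J, Φ x ψ = ((∫ z in J, (dx 0 φ z ψ ^ 2 + dx 1 φ z ψ ^ 2))
        + ∫ z in J, (dx 1 φ z ψ ^ 2 + dx 2 φ z ψ ^ 2)) * μ ψ := by
      have i : ∀ k, IntegrableOn (fun z => dx k φ z ψ ^ 2 + dx (k + 1) φ z ψ ^ 2) J := fun k =>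
        (((hdc k).pow 2).add ((hdc (k + 1)).pow 2)).integrableOn_Icc
      rw [← integral_add (i 0) (i 1), ← integral_mul_const]
      refine integral_congr_ae (Eventually.of_forall fun z => ?_)
      simp only [hΦ]
      ring
    have h1 := h.abs_divDensityDx_le (hJ0 x hx) hψ'
    have h2 := (h.fixed_weight_bounds (hJ0 x hx) (hJR x hx) hψ').1
    have h3 := hμ0 ψ hψ'
    have hd0 : φ x ψ = dx 0 φ x ψ := by rw [dx_zero]
    rw [Real.norm_eq_abs]
    calc |divDensityDx f ε φ x ψ|
        ≤ 4 * ((φ x ψ ^ 2 + dx 1 φ x ψ ^ 2) * ((1 + ψ) / vel f ε φ x ψ)) := h1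
      _ ≤ 4 * ((φ x ψ ^ 2 + dx 1 φ x ψ ^ 2) * (2 * μ ψ)) := by gcongr
      _ = 8 * ((dx 0 φ x ψ ^ 2 + dx 1 φ x ψ ^ 2) * μ ψ) := by
        rw [hd0]
        ring
      _ ≤ 8 * (((dx 0 φ x₀ ψ ^ 2 + ∫ z in J, (dx 0 φ z ψ ^ 2 + dx 1 φ z ψ ^ 2))
          + (dx 1 φ x₀ ψ ^ 2 + ∫ z in J, (dx 1 φ z ψ ^ 2 + dx 2 φ z ψ ^ 2))) * μ ψ) := by
        gcongr
      _ = _ := by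
        rw [e]
        ring
  · exact (((hk 0 (by norm_num) x₀ hx₀J).1.add (hk 1 (by norm_num) x₀ hx₀J).1).add
      hΦint).const_mul 8
  · filter_upwards [self_mem_ae_restrict measurableSet_Ioi] with ψ hψ x hx
    exact h.hasDerivAt_divDensity (hJ0 x hx) hψ

/-! ### The energy inequality -/

/-- The pointwise energy inequality: after division by `u`, the sum of `A` and the contribution
`ū_yy / (4 u²)` of `∂ₓ(1 / u)` is a damping term, so that only a cubic error in `φ` remains. -/
theorem half_divDensityDx_le (h : IsSmallSolution f ε K σ M φ) {x ψ : ℝ} (hx : 0 < x)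
    (hψ : 0 < ψ) : 1 / 2 * divDensityDx f ε φ x ψ
      ≤ φ x ψ * dpsi (dpsi φ) x ψ * (1 + ψ)
        + ε * (ratioConst (2 * shearProfile f 1) * (normX f ε σ K φ).toReal
          * ((x + 1) ^ σ 1 / (x + 1) ^ (1 / 4 : ℝ)))
          * |φ x ψ * dx 1 φ x ψ * ((1 + ψ) / vel f ε φ x ψ)| := by
  have hr : 0 < √(x + 1) := Real.sqrt_pos.2 (by linarith)
  have hu := h.vel_pos hx hψ
  have hb := h.blasius.ubar_pos hx hψ
  obtain ⟨hb1, -⟩ := h.vel_sq_bounds hx hψ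
  have hY := (h.ubarYY_bounds hx hψ).1
  have hφ := h.abs_le_mul_ubar_sq hx hψ
  have hs := h.slice hx
  have ht := hs.t_pos
  have hq := hs.q_pos
  have hN := hs.N_nonneg
  have hR := h.ratioConst_nonneg
  have hε := h.eps_pos
  have heq := h.sol.eqn x ψ hx hψ
  rw [h.ubar_add_eps_rho, h.coeffA_eq] at heq
  rw [← h.blasius.ubar_sq hx hψ] at hb1 hφ
  rw [divDensityDx]
  have hZ0 : 0 ≤ ratioConst (2 * shearProfile f 1) * (normX f ε σ K φ).toReal
    * ((x + 1) ^ σ 1 / (x + 1) ^ (1 / 4 : ℝ)) := by positivity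
  set Z := ratioConst (2 * shearProfile f 1) * (normX f ε σ K φ).toReal
    * ((x + 1) ^ σ 1 / (x + 1) ^ (1 / 4 : ℝ))
  set u := vel f ε φ x ψ
  set b := ubar f x ψ
  set p := φ x ψ
  set k := dx 1 φ x ψ
  set Y := ubarYY f x ψ
  set g₂ := dpsi (dpsi φ) x ψ
  have hdamp : 0 ≤ 2 * -Y / (b * (b + u)) - -Y / (4 * u ^ 2) := by
    have hbu : b ≤ 2 * u := by nlinarith
    rw [sub_nonneg, div_le_div_iff₀ (by positivity) (by positivity)]
    have : b * (b + u) ≤ 8 * u ^ 2 := by nlinarith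
    nlinarith
  have hcubic : -(p ^ 2 * (ε * k) / (4 * u ^ 3)) * (1 + ψ)
      ≤ ε * Z * |p * k * ((1 + ψ) / u)| := by
    have hw : 0 ≤ (1 + ψ) / u := by positivity
    have h1 : |p| / (4 * u ^ 2) ≤ Z := by
      rw [div_le_iff₀ (by positivity)]
      exact hφ.trans (mul_le_mul_of_nonneg_left hb1 hZ0)
    calc -(p ^ 2 * (ε * k) / (4 * u ^ 3)) * (1 + ψ)
        ≤ |-(p ^ 2 * (ε * k) / (4 * u ^ 3)) * (1 + ψ)| := le_abs_self _
      _ = ε * (|p| / (4 * u ^ 2)) * |p * k * ((1 + ψ) / u)| := by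
        have e : -(p ^ 2 * (ε * k) / (4 * u ^ 3)) * (1 + ψ)
            = -(ε * (p / (4 * u ^ 2)) * (p * k * ((1 + ψ) / u))) := by
          field_simp
        rw [e, abs_neg, abs_mul, abs_mul, abs_div, abs_of_pos hε,
          abs_of_pos (show 0 < 4 * u ^ 2 by positivity)]
      _ ≤ _ := by gcongr
  have hmain : 1 / 2 * ((2 * (p * k) / u - p ^ 2 * (Y + ε * k) / (2 * u ^ 3)) * (1 + ψ))
      = p * g₂ * (1 + ψ) - p ^ 2 * (1 + ψ) / u * (2 * -Y / (b * (b + u)) - -Y / (4 * u ^ 2))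
        + -(p ^ 2 * (ε * k) / (4 * u ^ 3)) * (1 + ψ) := by
    have hk : k = u * g₂ - 2 * -Y / (b * (b + u)) * p := by linarith
    have h1 : p * k / u = p * g₂ - p ^ 2 / u * (2 * -Y / (b * (b + u))) := by
      rw [hk]
      field_simp
    calc _ = (p * k / u) * (1 + ψ) - p ^ 2 * (Y + ε * k) / (4 * u ^ 3) * (1 + ψ) := by ring
      _ = _ := by
        rw [h1]
        field_simp
        ring
  have hd : 0 ≤ p ^ 2 * (1 + ψ) / u * (2 * -Y / (b * (b + u)) - -Y / (4 * u ^ 2)) := by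
    positivity
  rw [hmain]
  linarith

theorem integrable_mul_dx (h : IsSmallSolution f ε K σ M φ) {x : ℝ} (hx : 0 < x) :
    IntegrableOn (fun ψ => φ x ψ * dx 1 φ x ψ * ((1 + ψ) / vel f ε φ x ψ)) (Ioi 0) ∧
      ∫ ψ in Ioi (0 : ℝ), |φ x ψ * dx 1 φ x ψ * ((1 + ψ) / vel f ε φ x ψ)|
        ≤ (normX f ε σ K φ).toReal * ((normX f ε σ K φ).toReal * (x + 1) ^ (σ 1 - 1)) := by
  have hone : 1 ≤ K := one_le_two.trans h.two_le
  obtain ⟨i0, l0⟩ := h.integral_dx_sq_le (Nat.zero_le K) hx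
  obtain ⟨i1, l1⟩ := h.integral_dx_sq_le hone hx
  simp only [dx_zero, h.sigma_zero, Nat.cast_zero, sub_zero, Real.rpow_zero, mul_one] at i0 l0
  rw [Nat.cast_one] at l1
  have hN : 0 ≤ (normX f ε σ K φ).toReal := ENNReal.toReal_nonneg
  refine integrable_of_sq_le_mul ?_ i0 i1 ?_ ?_ ?_ hN
    (mul_nonneg hN (Real.rpow_nonneg (by linarith) _)) l0 l1
  · refine ContinuousOn.aestronglyMeasurable ?_ measurableSet_Ioi
    exact ((h.contDiffOn_slice hx).continuousOn.mul
      ((h.continuousOn_dx hone hx).mono Ioi_subset_Ici_self)).mul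
      (ContinuousOn.div (by fun_prop) (h.continuousOn_vel hx) fun ψ hψ => (h.vel_pos hx hψ).ne')
  all_goals
    filter_upwards [self_mem_ae_restrict measurableSet_Ioi] with ψ hψ
    have hψ' : (0 : ℝ) < ψ := hψ
    have hu := h.vel_pos hx hψ'
  · positivity
  · positivity
  · apply le_of_eq
    ring

theorem dissDensity_eq (φ : ℝ → ℝ → ℝ) (x : ℝ) {ψ : ℝ} (hψ : 0 < ψ) :
    dissDensity φ x ψ = dpsi φ x ψ ^ 2 * (1 + ψ) := by
  rw [dissDensity, bracket, abs_of_pos hψ]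

theorem integrableOn_dissDensity (h : IsSmallSolution f ε K σ M φ) {x : ℝ} (hx : 0 < x) :
    IntegrableOn (dissDensity φ x) (Ioi 0) :=
  ((h.slice hx).integral_sq_deriv h.blasius).1.congr_fun
    (fun _ hψ => (dissDensity_eq φ x hψ).symm) measurableSet_Ioi

theorem energy_inequality (h : IsSmallSolution f ε K σ M φ) {x : ℝ} (hx : 0 < x) :
    1 / 2 * deriv (divEnergy f ε φ) x + dissipation φ x
      ≤ ε * bracket x ^ (-(1 + 1 / 8) : ℝ)
        * (ratioConst (2 * shearProfile f 1) * M ^ 2 * (normX f ε σ K φ).toReal) := by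
  have hx1 : 0 < x + 1 := by linarith
  have hN : 0 ≤ (normX f ε σ K φ).toReal := ENNReal.toReal_nonneg
  have hR := h.ratioConst_nonneg
  have hε := h.eps_pos
  have hNM := h.norm_toReal_le
  have hs := h.slice hx
  obtain ⟨hF, hder⟩ := h.hasDerivAt_divEnergy hx
  obtain ⟨hm, hmle⟩ := h.integrable_mul_dx hx
  have hj := (hs.integrable_mul₂ h.blasius).1
  have hdiss : dissipation φ x ≤ -∫ ψ in Ioi (0 : ℝ), φ x ψ * dpsi (dpsi φ) x ψ * (1 + ψ) := by
    rw [dissipation, setIntegral_congr_fun measurableSet_Ioi fun ψ hψ => dissDensity_eq φ x hψ]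
    exact (hs.integral_sq_deriv h.blasius).2
  set N := (normX f ε σ K φ).toReal
  set c := ratioConst (2 * shearProfile f 1)
  have hZ0 : 0 ≤ ε * (c * N * ((x + 1) ^ σ 1 / (x + 1) ^ (1 / 4 : ℝ))) := by positivity
  have hmono := setIntegral_mono_on (hF.const_mul (1 / 2))
    (hj.add (hm.abs.const_mul (ε * (c * N * ((x + 1) ^ σ 1 / (x + 1) ^ (1 / 4 : ℝ))))))
    measurableSet_Ioi fun ψ hψ => h.half_divDensityDx_le hx hψ
  have hadd := integral_add hj
    (hm.abs.const_mul (ε * (c * N * ((x + 1) ^ σ 1 / (x + 1) ^ (1 / 4 : ℝ)))))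
  simp only [Pi.add_apply] at hmono
  rw [hadd, integral_const_mul, integral_const_mul] at hmono
  have herr := mul_le_mul_of_nonneg_left hmle hZ0
  have hpow : (x + 1) ^ σ 1 / (x + 1) ^ (1 / 4 : ℝ) * (x + 1) ^ (σ 1 - 1)
      ≤ (x + 1) ^ (-(1 + 1 / 8) : ℝ) := by
    rw [← Real.rpow_sub hx1, ← Real.rpow_add hx1]
    -- the exponent on the left is `2 σ₁ - 5 / 4`, and `σ₁ ≤ 1 / 16`
    exact Real.rpow_le_rpow_of_exponent_le (by linarith) (by linarith [h.sigma_one_le])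
  have hbr : bracket x = x + 1 := by
    rw [bracket, abs_of_pos hx]
    ring
  have hfin : ε * (c * N * ((x + 1) ^ σ 1 / (x + 1) ^ (1 / 4 : ℝ)))
      * (N * (N * (x + 1) ^ (σ 1 - 1)))
      ≤ ε * (x + 1) ^ (-(1 + 1 / 8) : ℝ) * (c * M ^ 2 * N) := by
    have hp0 : 0 ≤ (x + 1) ^ (-(1 + 1 / 8) : ℝ) := Real.rpow_nonneg hx1.le _
    calc _ = ε * ((x + 1) ^ σ 1 / (x + 1) ^ (1 / 4 : ℝ) * (x + 1) ^ (σ 1 - 1))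
          * (c * N ^ 2 * N) := by ring
      _ ≤ ε * (x + 1) ^ (-(1 + 1 / 8) : ℝ) * (c * M ^ 2 * N) := by gcongr
  rw [hder.deriv, hbr]
  linarith

end IsSmallSolution

end VonMises

theorem mainTheorem3 (f : ℝ → ℝ) (hf : VonMises.IsBlasiusProfile f) :
    ∃ κ : ℝ, 0 < κ ∧ ∃ σmax : ℝ, 0 < σmax ∧ ∃ Kmin : ℕ, ∀ K₀ : ℕ, Kmin ≤ K₀ →
      ∀ σ : ℕ → ℝ, σ 0 = 0 → (∀ k : ℕ, σ k < σ (k + 1)) → (∀ k : ℕ, k ≤ K₀ → σ k ≤ σmax) →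
      ∀ M : ℝ, 0 < M → ∃ ε₀ : ℝ, 0 < ε₀ ∧ ∃ C : ℝ, 0 < C ∧
      ∀ ε : ℝ, 0 < ε → ε ≤ ε₀ → ∀ φ : ℝ → ℝ → ℝ,
        VonMises.IsSolution f ε K₀ φ →
        VonMises.normX f ε σ K₀ φ ≤ ENNReal.ofReal M →
        (∀ x : ℝ, 0 < x →
          MeasureTheory.IntegrableOn (VonMises.divDensity f ε φ x) (Set.Ioi 0) ∧
          MeasureTheory.IntegrableOn (VonMises.dissDensity φ x) (Set.Ioi 0) ∧
          DifferentiableAt ℝ (VonMises.divEnergy f ε φ) x) ∧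
        ∃ E : ℝ → ℝ,
          (∀ x : ℝ, 0 < x → |E x| ≤ C * (VonMises.normX f ε σ K₀ φ).toReal) ∧
          ∀ x : ℝ, 0 < x →
            1 / 2 * deriv (VonMises.divEnergy f ε φ) x + VonMises.dissipation φ x
              ≤ ε * VonMises.bracket x ^ (-(1 + κ)) * E x := by
  refine ⟨1 / 8, by norm_num, 1 / 16, by norm_num, 2, fun K₀ hK σ hσ0 hσ hσle M hM => ?_⟩
  have hc := hf.shearProfile_pos one_pos
  set c := 2 * VonMises.shearProfile f 1 with hcdef
  have hc0 : 0 < c := by positivity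
  have hW := VonMises.wallConst_pos c
  have hR : 0 < VonMises.ratioConst c := by
    rw [VonMises.ratioConst]
    positivity
  refine ⟨min (3 / (2 * M)) (min (c / (4 * (VonMises.wallConst c * M)))
    (3 / (4 * (VonMises.ratioConst c * M)))), by positivity,
    VonMises.ratioConst c * M ^ 2, by positivity, fun ε hε hεle φ hφ hnorm => ?_⟩
  obtain ⟨h1, h23⟩ := le_min_iff.1 hεle
  obtain ⟨h2, h3⟩ := le_min_iff.1 h23
  rw [le_div_iff₀ (by positivity)] at h1 h2 h3
  have h : VonMises.IsSmallSolution f ε K₀ σ M φ :=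
    { blasius := hf
      eps_pos := hε
      two_le := hK
      sol := hφ
      norm_le := hnorm
      M_pos := hM
      sigma_zero := hσ0
      sigma_one_pos := hσ0 ▸ hσ 0
      sigma_one_le := hσle 1 (one_le_two.trans hK)
      sigma_two_le := hσle 2 hK
      small₁ := h1
      small₂ := by
        rw [← hcdef]
        linarith
      small₃ := by
        rw [← hcdef]
        linarith }
  have hN : 0 ≤ (VonMises.normX f ε σ K₀ φ).toReal := ENNReal.toReal_nonneg
  refine ⟨fun x hx => ⟨h.integrableOn_divDensity hx, h.integrableOn_dissDensity hx,
    (h.hasDerivAt_divEnergy hx).2.differentiableAt⟩,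
    fun _ => VonMises.ratioConst c * M ^ 2 * (VonMises.normX f ε σ K₀ φ).toReal,
    fun x _ => ?_, fun x hx => h.energy_inequality hx⟩
  rw [abs_of_nonneg (by positivity)]
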